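/- Let $F_1\in\mathbb R^{n\times n_1}$ be given, let $x_1,\dots,x_T\in\mathbb R^n$, and let $w_1,\dots,w_T\ge 0$ with $\sum_\tau w_\tau=1$. Put $C=\sum_\tau w_\tau x_\tau x_\tau^\top$. A parameter is $\theta=(F_2,\Omega,D)$ with $F_2\in\mathbb R^{n\times n_2}$, $\Omega\in\mathbb R^{n_1\times n_1}$ positive definite and $D\in\mathbb R^{n\times n}$ diagonal with positive diagonal entries; write $\tilde F=[F_1\ F_2]$ and $\tilde\Omega=\begin{bmatrix}\Omega&0\\0&I\end{bmatrix}$. The model is $X=\tilde FS+E$ with independent $S\sim\mathcal N(0,\tilde\Omega)$ and $E\sim\mathcal N(0,D)$. Let $p_\theta(x)$ be the density of $\mathcal N(0,\tilde F\tilde\Omega\tilde F^\top+D)$, $p_\theta(x,s)=\mathcal N(x;\tilde Fs,D)\,\mathcal N(s;0,\tilde\Omega)$ the joint density of $(X,S)$, and $p_\theta(s\mid x)=p_\theta(x,s)/p_\theta(x)$. Given $\theta$ set $$G=(\tilde F^\top D^{-1}\tilde F+\tilde\Omega^{-1})^{-1},\quad L=G\tilde F^\top D^{-1}=\begin{bmatrix}L_1\\L_2\end{bmatrix},\quad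 C_{ss}=G+LCL^\top=\begin{bmatrix}C_{ss,11}&C_{ss,12}\\C_{ss,12}^\top&C_{ss,22}\end{bmatrix},\quad C_{xs}=CL^\top=[C_{xs,1}\ C_{xs,2}],$$ and define the update $\theta^+=(F_2^+,\Omega^+,D^+)$ by $$\Omega^+=C_{ss,11},\qquad F_2^+=(C_{xs,2}-F_1C_{ss,12})C_{ss,22}^{-1},\qquad D^+=\operatorname{diag}\bigl(C-2C_{xs}\tilde F^{+\top}+\tilde F^+C_{ss}\tilde F^{+\top}\bigr),\quad \tilde F^+=[F_1\ F_2^+].$$ 1. (E-step) For every parameter $\theta$: $X\sim\mathcal N(0,\tilde F\tilde\Omega\tilde F^\top+D)$, $(X,S)$ has density $p_\theta(x,s)$, $\int p_\theta(x,s)\,ds=p_\theta(x)>0$, and the conditional law of $S$ given $X=x$ is $\mathcal N(Lx,G)$ (as a regular conditional distribution, and, through the density $p_\theta(\cdot\mid x)$, for every $x$), where $G$ is positive definite. Moreover $C_{ss}=\sum_\tau w_\tau\mathbb E[SS^\top\mid X=x_\tau]$ and $C_{xs}=\sum_\tau w_\tau\mathbb E[x_\tau S^\top\mid X=x_\tau]$.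 2. (Two forms of the update) For every parameter $\theta$, $C_{ss,22}$ is positive definite, and with $\tilde\Sigma=C+F_1C_{ss,11}F_1^\top-2CL_1^\top F_1^\top$ and $\tilde C_{xs}=CL_2^\top-F_1C_{ss,12}$ one has $F_2^+=\tilde C_{xs}C_{ss,22}^{-1}$ and $D^+=\operatorname{diag}(\tilde\Sigma-\tilde C_{xs}C_{ss,22}^{-1}\tilde C_{xs}^\top)$. 3. (Objectives) For parameters $\theta,\theta_k$ let $Q(\theta\,\|\,\theta_k)=\sum_\tau w_\tau\,\mathbb E_{s\sim p_{\theta_k}(\cdot\mid x_\tau)}\log p_\theta(x_\tau,s)$ and $\ell(\theta)=\sum_\tau w_\tau\log p_\theta(x_\tau)$. The expectations involved are finite, and $Q(\theta\,\|\,\theta_k)=\mathbb E_{x\sim\mathcal N(0,C)}\mathbb E_{s\sim p_{\theta_k}(\cdot\mid x)}\log p_\theta(x,s)$, $\ell(\theta)=\mathbb E_{x\sim\mathcal N(0,C)}\log p_\theta(x)=:J(\theta)$. 4. (M-step and monotonicity) Assume that for every asset $i\in\{1,\dots,n\}$ the $i$-th row of $F_1$ is non-zero or $(x_\tau)_i\ne0$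 for some $\tau$ with $w_\tau>0$. Then for every parameter $\theta_k$ the update $\theta_{k+1}=\theta_k^+$ is again a parameter ($\Omega^+$ positive definite, $D^+$ with positive diagonal), and it is the unique maximizer of $\theta\mapsto Q(\theta\,\|\,\theta_k)$ over all parameters, for both forms of the objective in 3. Consequently, for every initial parameter $\theta_0$, all iterates $\theta_{k+1}=\theta_k^+$ are parameters, and $\ell(\theta_{k+1})\ge\ell(\theta_k)$ and $J(\theta_{k+1})\ge J(\theta_k)$ for all $k\ge0$. 5. (Initialization) Let $\Omega_{\mathrm{base}}$ be positive definite and $\nu>0$. Let $e_\tau$ be the residuals of the least-squares regressions of $x_\tau$ on $F_1$, and let $U\Lambda U^\top$ be the part of the eigendecomposition of $\frac1T\sum_\tau e_\tau e_\tau^\top$ belonging to its $n_2$ largest eigenvalues. Then $F_2=U\Lambda^{1/2}$, $\Omega=\Omega_{\mathrm{base}}$, $D=\max\{\operatorname{diag}(C-\tilde F\tilde\Omega\tilde F^\top),\nu\}$ (elementwise) is a parameter, so that 4 applies to the EM algorithm started from it. -/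

import Mathlib

open MeasureTheory ProbabilityTheory Matrix

namespace FactorEM

/-- The matrix-vector product, as a map between Euclidean spaces. -/
noncomputable def mulE {ι κ : Type*} [Fintype κ] (A : Matrix ι κ ℝ) (v : EuclideanSpace ℝ κ) :
    EuclideanSpace ℝ ι :=
  WithLp.toLp 2 (A *ᵥ WithLp.ofLp v)

/-- The density of the Gaussian distribution `N(m, V)` (for `V` positive definite) with respect to
Lebesgue measure. -/
noncomputable def gaussianDensity {ι : Type*} [Fintype ι] [DecidableEq ι]
    (m : EuclideanSpace ℝ ι) (V : Matrix ι ι ℝ) (x : EuclideanSpace ℝ ι) : ℝ :=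
  (Real.sqrt ((2 * Real.pi) ^ Fintype.card ι * V.det))⁻¹ *
    Real.exp (-(1 / 2) * (WithLp.ofLp (x - m) ⬝ᵥ (V⁻¹ *ᵥ WithLp.ofLp (x - m))))

/-- The parameters `θ = (F₂, Ω, D)` of the extended model; the diagonal matrix `D` is stored as the
vector of its diagonal entries. -/
@[ext]
structure Params (n n₁ n₂ : ℕ) where
  F₂ : Matrix (Fin n) (Fin n₂) ℝ
  Ω : Matrix (Fin n₁) (Fin n₁) ℝ
  D : Fin n → ℝ

variable {n n₁ n₂ T : ℕ}

/-- `Ω` is positive definite and `D` has positive diagonal entries. -/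
def Params.Admissible (θ : Params n n₁ n₂) : Prop :=
  θ.Ω.PosDef ∧ ∀ i, 0 < θ.D i

/-- `D` as a matrix. -/
def Params.Dmat (θ : Params n n₁ n₂) : Matrix (Fin n) (Fin n) ℝ :=
  Matrix.diagonal θ.D

/-- `Ω̃ = [[Ω, 0], [0, I]]`. -/
def Params.Ωtilde (θ : Params n n₁ n₂) :
    Matrix (Fin n₁ ⊕ Fin n₂) (Fin n₁ ⊕ Fin n₂) ℝ :=
  Matrix.fromBlocks θ.Ω 0 0 1

/-- `F̃ = [F₁ F₂]`. -/
def Params.Ftilde (F₁ : Matrix (Fin n) (Fin n₁) ℝ) (θ : Params n n₁ n₂) :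
    Matrix (Fin n) (Fin n₁ ⊕ Fin n₂) ℝ :=
  Matrix.fromCols F₁ θ.F₂

/-- The model covariance `F̃ Ω̃ F̃ᵀ + D`. -/
def modelCov (F₁ : Matrix (Fin n) (Fin n₁) ℝ) (θ : Params n n₁ n₂) :
    Matrix (Fin n) (Fin n) ℝ :=
  θ.Ftilde F₁ * θ.Ωtilde * (θ.Ftilde F₁)ᵀ + θ.Dmat

/-- `p_θ(x)`, the density of `N(0, F̃ Ω̃ F̃ᵀ + D)`. -/
noncomputable def returnDensity (F₁ : Matrix (Fin n) (Fin n₁) ℝ) (θ : Params n n₁ n₂)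
    (x : EuclideanSpace ℝ (Fin n)) : ℝ :=
  gaussianDensity 0 (modelCov F₁ θ) x

/-- `p_θ(x, s)`, the joint density of returns and factors: `s ~ N(0, Ω̃)`, `x | s ~ N(F̃ s, D)`. -/
noncomputable def jointDensity (F₁ : Matrix (Fin n) (Fin n₁) ℝ) (θ : Params n n₁ n₂)
    (x : EuclideanSpace ℝ (Fin n)) (s : EuclideanSpace ℝ (Fin n₁ ⊕ Fin n₂)) : ℝ :=
  gaussianDensity (mulE (θ.Ftilde F₁) s) θ.Dmat x * gaussianDensity 0 θ.Ωtilde s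

/-- `q(s; x) = p_θ(s | x)`, the conditional density of the factors given the returns. -/
noncomputable def condDensity (F₁ : Matrix (Fin n) (Fin n₁) ℝ) (θ : Params n n₁ n₂)
    (x : EuclideanSpace ℝ (Fin n)) (s : EuclideanSpace ℝ (Fin n₁ ⊕ Fin n₂)) : ℝ :=
  jointDensity F₁ θ x s / returnDensity F₁ θ x

/-- `G`, with `G⁻¹ = F̃ᵀ D⁻¹ F̃ + Ω̃⁻¹`. -/
noncomputable def postCov (F₁ : Matrix (Fin n) (Fin n₁) ℝ) (θ : Params n n₁ n₂) :
    Matrix (Fin n₁ ⊕ Fin n₂) (Fin n₁ ⊕ Fin n₂) ℝ :=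
  ((θ.Ftilde F₁)ᵀ * θ.Dmat⁻¹ * θ.Ftilde F₁ + θ.Ωtilde⁻¹)⁻¹

/-- `L = G F̃ᵀ D⁻¹`. -/
noncomputable def postGain (F₁ : Matrix (Fin n) (Fin n₁) ℝ) (θ : Params n n₁ n₂) :
    Matrix (Fin n₁ ⊕ Fin n₂) (Fin n) ℝ :=
  postCov F₁ θ * (θ.Ftilde F₁)ᵀ * θ.Dmat⁻¹

/-- `C = ∑ τ, w τ x_τ x_τᵀ`. -/
def secondMoment (x : Fin T → EuclideanSpace ℝ (Fin n)) (w : Fin T → ℝ) :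
    Matrix (Fin n) (Fin n) ℝ :=
  ∑ τ, w τ • Matrix.vecMulVec (WithLp.ofLp (x τ)) (WithLp.ofLp (x τ))

/-- `C_ss = G + L C Lᵀ`. -/
noncomputable def Css (F₁ : Matrix (Fin n) (Fin n₁) ℝ) (C : Matrix (Fin n) (Fin n) ℝ)
    (θ : Params n n₁ n₂) : Matrix (Fin n₁ ⊕ Fin n₂) (Fin n₁ ⊕ Fin n₂) ℝ :=
  postCov F₁ θ + postGain F₁ θ * C * (postGain F₁ θ)ᵀ

/-- `C_xs = C Lᵀ`. -/
noncomputable def Cxs (F₁ : Matrix (Fin n) (Fin n₁) ℝ) (C : Matrix (Fin n) (Fin n) ℝ)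
    (θ : Params n n₁ n₂) : Matrix (Fin n) (Fin n₁ ⊕ Fin n₂) ℝ :=
  C * (postGain F₁ θ)ᵀ

/-- The new exposures `(C_xs,2 - F₁ C_ss,12) C_ss,22⁻¹`. -/
noncomputable def newF₂ (F₁ : Matrix (Fin n) (Fin n₁) ℝ) (C : Matrix (Fin n) (Fin n) ℝ)
    (θ : Params n n₁ n₂) : Matrix (Fin n) (Fin n₂) ℝ :=
  ((Cxs F₁ C θ).toCols₂ - F₁ * (Css F₁ C θ).toBlocks₁₂) * ((Css F₁ C θ).toBlocks₂₂)⁻¹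

/-- One pass of the loop of the algorithm: `Ω ← C_ss,11`, `F₂ ← (C_xs,2 - F₁ C_ss,12) C_ss,22⁻¹`,
and, with the new `F̃ = [F₁ F₂]`, `D ← diag (C - 2 C_xs F̃ᵀ + F̃ C_ss F̃ᵀ)`. -/
noncomputable def emStep (F₁ : Matrix (Fin n) (Fin n₁) ℝ) (C : Matrix (Fin n) (Fin n) ℝ)
    (θ : Params n n₁ n₂) : Params n n₁ n₂ where
  F₂ := newF₂ F₁ C θ
  Ω := (Css F₁ C θ).toBlocks₁₁
  D := Matrix.diag (C - (2 : ℝ) • (Cxs F₁ C θ * (Matrix.fromCols F₁ (newF₂ F₁ C θ))ᵀ) +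
    Matrix.fromCols F₁ (newF₂ F₁ C θ) * Css F₁ C θ * (Matrix.fromCols F₁ (newF₂ F₁ C θ))ᵀ)

/-- `Σ̃ = C + F₁ C_ss,11 F₁ᵀ - 2 C L₁ᵀ F₁ᵀ`. -/
noncomputable def sigmaTilde (F₁ : Matrix (Fin n) (Fin n₁) ℝ) (C : Matrix (Fin n) (Fin n) ℝ)
    (θ : Params n n₁ n₂) : Matrix (Fin n) (Fin n) ℝ :=
  C + F₁ * (Css F₁ C θ).toBlocks₁₁ * F₁ᵀ - (2 : ℝ) • (C * (postGain F₁ θ).toRows₁ᵀ * F₁ᵀ)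

/-- `C̃_xs = C L₂ᵀ - F₁ C_ss,12`. -/
noncomputable def CxsTilde (F₁ : Matrix (Fin n) (Fin n₁) ℝ) (C : Matrix (Fin n) (Fin n) ℝ)
    (θ : Params n n₁ n₂) : Matrix (Fin n) (Fin n₂) ℝ :=
  C * (postGain F₁ θ).toRows₂ᵀ - F₁ * (Css F₁ C θ).toBlocks₁₂

/-- `E_{s ~ q_k(·; x)} log p_θ(x, s)`, where `q_k(s; x) = p_{θk}(s | x)`. -/
noncomputable def expectedLogJoint (F₁ : Matrix (Fin n) (Fin n₁) ℝ) (θ θk : Params n n₁ n₂)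
    (x : EuclideanSpace ℝ (Fin n)) : ℝ :=
  ∫ s, condDensity F₁ θk x s * Real.log (jointDensity F₁ θ x s)

/-- The objective `Q(θ ‖ θk) = ∑ τ, w τ E_{s ~ q_k(·; x_τ)} log p_θ(x_τ, s)` of the M-step. -/
noncomputable def Qweighted (F₁ : Matrix (Fin n) (Fin n₁) ℝ) (x : Fin T → EuclideanSpace ℝ (Fin n))
    (w : Fin T → ℝ) (θ θk : Params n n₁ n₂) : ℝ :=
  ∑ τ, w τ * expectedLogJoint F₁ θ θk (x τ)

/-- The M-step objective with the weighted sum replaced by the expectation over `N(0, C)`. -/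
noncomputable def Qgaussian (F₁ : Matrix (Fin n) (Fin n₁) ℝ) (C : Matrix (Fin n) (Fin n) ℝ)
    (θ θk : Params n n₁ n₂) : ℝ :=
  ∫ x, expectedLogJoint F₁ θ θk x ∂(multivariateGaussian 0 C)

/-- The weighted log-likelihood `∑ τ, w τ log p_θ(x_τ)`. -/
noncomputable def logLik (F₁ : Matrix (Fin n) (Fin n₁) ℝ) (x : Fin T → EuclideanSpace ℝ (Fin n))
    (w : Fin T → ℝ) (θ : Params n n₁ n₂) : ℝ :=
  ∑ τ, w τ * Real.log (returnDensity F₁ θ (x τ))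

/-- The expected log-likelihood `J(θ) = E_{x ~ N(0, C)} log p_θ(x)`. -/
noncomputable def expLogLik (F₁ : Matrix (Fin n) (Fin n₁) ℝ) (C : Matrix (Fin n) (Fin n) ℝ)
    (θ : Params n n₁ n₂) : ℝ :=
  ∫ x, Real.log (returnDensity F₁ θ x) ∂(multivariateGaussian 0 C)

/-- `θ₀` is an initialization of the algorithm: the returns are regressed on `F₁` by least squares,
with residuals `e τ`; `U` and `Λ` hold orthonormal eigenvectors and eigenvalues for the `n₂` largest
eigenvalues of `(1/T) ∑ τ, e_τ e_τᵀ`; then `F₂ = U Λ^{1/2}`, `Ω = Ω_base` and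
`D = max (diag (C - F̃ Ω̃ F̃ᵀ), ν)` elementwise. -/
def IsInitialization (F₁ : Matrix (Fin n) (Fin n₁) ℝ) (Ωbase : Matrix (Fin n₁) (Fin n₁) ℝ)
    (x : Fin T → EuclideanSpace ℝ (Fin n)) (w : Fin T → ℝ) (ν : ℝ) (θ₀ : Params n n₁ n₂) : Prop :=
  (∃ (β : Fin T → EuclideanSpace ℝ (Fin n₁)) (e : Fin T → EuclideanSpace ℝ (Fin n))
      (S : Matrix (Fin n) (Fin n) ℝ) (U : Matrix (Fin n) (Fin n₂) ℝ) (Λ : Fin n₂ → ℝ),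
    (∀ τ, e τ = x τ - mulE F₁ (β τ)) ∧
    (∀ τ b, ‖e τ‖ ≤ ‖x τ - mulE F₁ b‖) ∧
    S = (1 / (T : ℝ)) • ∑ τ, Matrix.vecMulVec (WithLp.ofLp (e τ)) (WithLp.ofLp (e τ)) ∧
    Uᵀ * U = 1 ∧
    S * U = U * Matrix.diagonal Λ ∧
    (∀ v : Fin n → ℝ, Uᵀ *ᵥ v = 0 → ∀ j, v ⬝ᵥ (S *ᵥ v) ≤ Λ j * (v ⬝ᵥ v)) ∧
    θ₀.F₂ = U * Matrix.diagonal (fun j => Real.sqrt (Λ j))) ∧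
  θ₀.Ω = Ωbase ∧
  ∀ i, θ₀.D i =
    max ((secondMoment x w - θ₀.Ftilde F₁ * θ₀.Ωtilde * (θ₀.Ftilde F₁)ᵀ) i i) ν

end FactorEM

/-!
Everything rests on Bayes' rule for the Gaussian linear model,
`p_θ(x, s) = p_θ(x) · N(s; L x, G)` (`gaussianDensity_mul_gaussianDensity`): the exponents agree by
completing the square, with the Woodbury identity for the inverse of `F̃ Ω̃ F̃ᵀ + D`, and the
normalizing constants by the matrix determinant lemma. Mathlib defines the multivariate Gaussian as
an image of the standard one, so it is first shown to have the usual density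
(`withDensity_gaussianDensity`). The joint law of `(X, S)` is then the image of a product density
under a shear, and the factorization of its density exhibits the posterior as a version of the
conditional distribution (`model_laws`).

Both objectives are averages over the returns of quadratic functions without linear term. Such
averages depend on the distribution of the returns only through its second-moment matrix, which is
`C` for the weighted sample and for `N(0, C)` alike; hence the two forms of each objective agree
(`HasSecondMoment.hasMean_expectedLogJoint`, `HasSecondMoment.hasMean_log_returnDensity`).

For the M-step, the objective is written as a constant minus half of
`∑ i, (log Dᵢ + Rᵢ(F₂) / Dᵢ) + log det Ω + tr (Ω⁻¹ C_ss,11)` (`Qmoments_eq`), where the residual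
variance `Rᵢ(F₂)` is its value at `F₂⁺` plus a positive definite quadratic form in row `i` of
`F₂ - F₂⁺` (`residualMoment_eq_add_quadratic`). The remaining minimizations are those of
`log d + r / d` and of its matrix analogue (`log_det_add_card_lt`), both consequences of
`log t < t - 1` for `t ≠ 1`. The new variances are positive because `Rᵢ` is the posterior variance
of the factor part of asset `i` plus a mean square (`residualMoment_diag_eq_add`).

Monotonicity is the usual argument: the log-likelihood exceeds the M-step objective by a term whose
change is a relative entropy (`expectedLogJoint_sub_le`).
-/

namespace FactorEM

open scoped ENNReal MatrixOrder

/-! ### Gaussian densities -/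

section

variable {ι : Type*} [Fintype ι]

lemma map_withDensity_comp {α β : Type*} [MeasurableSpace α] [MeasurableSpace β] (μ : Measure α)
    {φ : α → β} (hφ : Measurable φ) {f : β → ℝ≥0∞} (hf : Measurable f) :
    (μ.withDensity fun a => f (φ a)).map φ = (μ.map φ).withDensity f := by
  ext s hs
  rw [Measure.map_apply hφ hs, withDensity_apply _ (hφ hs), withDensity_apply _ hs,
    setLIntegral_map hs hf hφ]

lemma pi_gaussianReal_eq_withDensity :
    Measure.pi (fun _ : ι => gaussianReal 0 1) =
      (volume : Measure (ι → ℝ)).withDensity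
        fun x => ENNReal.ofReal (∏ i, gaussianPDFReal 0 1 (x i)) := by
  refine Measure.pi_eq fun s hs => ?_
  have hind (i : ι) : Integrable ((s i).indicator (gaussianPDFReal 0 1)) :=
    (integrable_gaussianPDFReal 0 1).indicator (hs i)
  have hnn (i : ι) (t : ℝ) : 0 ≤ (s i).indicator (gaussianPDFReal 0 1) t :=
    Set.indicator_nonneg (fun _ _ => gaussianPDFReal_nonneg _ _ _) _
  rw [withDensity_apply _ (MeasurableSet.univ_pi hs),
    ← lintegral_indicator (MeasurableSet.univ_pi hs)]
  -- indicators turn the integral over a box into the integral of a product of functions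
  have h1 (x : ι → ℝ) : (Set.univ.pi s).indicator
      (fun x => ENNReal.ofReal (∏ i, gaussianPDFReal 0 1 (x i))) x =
      ENNReal.ofReal (∏ i, (s i).indicator (gaussianPDFReal 0 1) (x i)) := by
    by_cases hx : x ∈ Set.univ.pi s
    · rw [Set.indicator_of_mem hx]
      congr 1
      exact Finset.prod_congr rfl fun i _ => (Set.indicator_of_mem (hx i trivial) _).symm
    · rw [Set.indicator_of_notMem hx]
      simp only [Set.mem_pi, Set.mem_univ, true_implies, not_forall] at hx
      obtain ⟨i, hi⟩ := hx
      rw [Finset.prod_eq_zero (Finset.mem_univ i) (Set.indicator_of_notMem hi _),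
        ENNReal.ofReal_zero]
  simp_rw [h1]
  rw [volume_pi, ← ofReal_integral_eq_lintegral_ofReal (Integrable.fintype_prod hind)
      (ae_of_all _ fun x => Finset.prod_nonneg fun i _ => hnn i _),
    integral_fintype_prod_eq_prod,
    ENNReal.ofReal_prod_of_nonneg fun i _ => integral_nonneg (hnn i)]
  refine Finset.prod_congr rfl fun i _ => ?_
  rw [gaussianReal_of_var_ne_zero _ one_ne_zero, withDensity_apply _ (hs i),
    ← lintegral_indicator (hs i),
    ofReal_integral_eq_lintegral_ofReal (hind i) (ae_of_all _ (hnn i))]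
  refine lintegral_congr fun t => ?_
  by_cases ht : t ∈ s i <;> simp [ht, gaussianPDF]

lemma continuous_mulE {ι κ : Type*} [Fintype κ] (A : Matrix ι κ ℝ) : Continuous (mulE A) := by
  unfold mulE; fun_prop

lemma continuous_gaussianDensity [DecidableEq ι] (m : EuclideanSpace ℝ ι) (V : Matrix ι ι ℝ) :
    Continuous (gaussianDensity m V) := by
  unfold gaussianDensity
  fun_prop

lemma gaussianDensity_nonneg [DecidableEq ι] (m : EuclideanSpace ℝ ι) (V : Matrix ι ι ℝ)
    (x : EuclideanSpace ℝ ι) : 0 ≤ gaussianDensity m V x := by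
  unfold gaussianDensity; positivity

lemma sqrt_det_factor_pos [DecidableEq ι] {V : Matrix ι ι ℝ} (hV : V.PosDef) :
    0 < Real.sqrt ((2 * Real.pi) ^ Fintype.card ι * V.det) := by
  have := hV.det_pos
  positivity

lemma gaussianDensity_pos [DecidableEq ι] (m : EuclideanSpace ℝ ι) {V : Matrix ι ι ℝ}
    (hV : V.PosDef)
    (x : EuclideanSpace ℝ ι) : 0 < gaussianDensity m V x := by
  have := sqrt_det_factor_pos hV
  unfold gaussianDensity
  positivity

lemma gaussianDensity_zero_one [DecidableEq ι] (x : ι → ℝ) :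
    gaussianDensity 0 1 (WithLp.toLp 2 x) = ∏ i, gaussianPDFReal 0 1 (x i) := by
  simp only [gaussianDensity, gaussianPDFReal, Finset.prod_mul_distrib, ← Real.exp_sum,
    Finset.prod_const, Finset.card_univ, inv_one, one_mulVec, det_one, mul_one, sub_zero,
    NNReal.coe_one, dotProduct, Finset.mul_sum]
  congr 1
  · rw [inv_pow, Real.sqrt_eq_rpow, Real.sqrt_eq_rpow, ← Real.rpow_natCast, ← Real.rpow_natCast,
      ← Real.rpow_mul (by positivity), ← Real.rpow_mul (by positivity), 
      mul_comm (1 / 2 : ℝ)]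
  · congr 1
    exact Finset.sum_congr rfl fun i _ => by ring

lemma stdGaussian_eq_withDensity [DecidableEq ι] :
    stdGaussian (EuclideanSpace ℝ ι) =
      volume.withDensity fun x => ENNReal.ofReal (gaussianDensity 0 1 x) := by
  rw [← map_pi_eq_stdGaussian, pi_gaussianReal_eq_withDensity]
  simp_rw [← gaussianDensity_zero_one]
  rw [map_withDensity_comp (φ := WithLp.toLp 2) (f := fun x => ENNReal.ofReal _) _ (by fun_prop)
    (continuous_gaussianDensity _ _).measurable.ennreal_ofReal,
    (PiLp.volume_preserving_toLp ι).map_eq]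

/-- The Gaussian measure with a positive definite covariance matrix `V` has the Gaussian density:
the standard Gaussian density is transported by the map `y ↦ m + √V y`. -/
lemma withDensity_gaussianDensity [DecidableEq ι] (m : EuclideanSpace ℝ ι) {V : Matrix ι ι ℝ}
    (hV : V.PosDef) :
    volume.withDensity (fun x => ENNReal.ofReal (gaussianDensity m V x)) =
      multivariateGaussian m V := by
  set R : Matrix ι ι ℝ := CFC.sqrt V with hR
  have hRR : R * R = V := CFC.sqrt_mul_sqrt_self _ hV.posSemidef.nonneg
  have hRs : Rᵀ = R := by
    have : IsSelfAdjoint R := (CFC.sqrt_nonneg V).isSelfAdjoint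
    rwa [IsSelfAdjoint, star_eq_conjTranspose, conjTranspose_eq_transpose_of_trivial] at this
  have hRdet : R.det = Real.sqrt V.det := by
    have := hV.posSemidef.det_sqrt
    rwa [RCLike.sqrt_of_nonneg hV.posSemidef.det_nonneg] at this
  have hRpos : 0 < R.det := by rw [hRdet]; exact Real.sqrt_pos.2 hV.det_pos
  have hRu : IsUnit R.det := hRpos.ne'.isUnit
  have hRVR : R * V⁻¹ * R = 1 := by
    rw [← hRR, Matrix.mul_inv_rev, Matrix.mul_assoc, Matrix.mul_assoc, Matrix.nonsing_inv_mul _ hRu,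
      Matrix.mul_one, Matrix.mul_nonsing_inv _ hRu]
  -- the density transforms by the factor `det R = √(det V)`
  set φ : EuclideanSpace ℝ ι → EuclideanSpace ℝ ι :=
    fun y => m + toEuclideanCLM (𝕜 := ℝ) R y with hφ
  have hφm : Measurable φ := by fun_prop
  have hvol : (volume : Measure (EuclideanSpace ℝ ι)).map φ =
      ENNReal.ofReal (R.det)⁻¹ • volume := by
    have h1 : φ = (fun y => m + y) ∘ (toEuclideanLin R) := by
      ext y; simp [hφ, ← coe_toEuclideanCLM_eq_toEuclideanLin]
    have hdet : LinearMap.det (toEuclideanLin R) = R.det := by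
      rw [toEuclideanLin, toLpLin_eq_toLin, LinearMap.det_toLin]
    rw [h1, ← Measure.map_map (by fun_prop)
        (LinearMap.continuous_of_finiteDimensional _).measurable,
      Measure.map_linearMap_addHaar_eq_smul_addHaar _ (by rw [hdet]; exact hRpos.ne'), hdet,
      Measure.map_smul, map_add_left_eq_self, abs_of_pos (by positivity)]
  have hpt (y : EuclideanSpace ℝ ι) :
      gaussianDensity 0 1 y = R.det * gaussianDensity m V (φ y) := by
    have h2 : WithLp.ofLp (φ y - m) = R *ᵥ WithLp.ofLp y := by
      simp [hφ]
    have h3 : (R *ᵥ WithLp.ofLp y) ⬝ᵥ (V⁻¹ *ᵥ (R *ᵥ WithLp.ofLp y)) =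
        WithLp.ofLp y ⬝ᵥ WithLp.ofLp y := by
      conv_lhs => enter [1]; rw [← hRs]
      rw [mulVec_transpose, ← dotProduct_mulVec, mulVec_mulVec, mulVec_mulVec,
        hRVR, one_mulVec]
    unfold gaussianDensity
    rw [h2, h3, Real.sqrt_mul (by positivity) V.det, ← hRdet]
    simp only [det_one, mul_one, sub_zero, inv_one, one_mulVec]
    field_simp
  have hmeas : Measurable fun x => ENNReal.ofReal (R.det * gaussianDensity m V x) :=
    ((continuous_gaussianDensity m V).measurable.const_mul _).ennreal_ofReal
  rw [multivariateGaussian, stdGaussian_eq_withDensity]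
  simp_rw [hpt]
  rw [map_withDensity_comp (f := fun x => ENNReal.ofReal (R.det * gaussianDensity m V x)) _ hφm
    hmeas, hvol, withDensity_smul_measure, ← withDensity_smul _ hmeas]
  congr 1
  ext x
  rw [Pi.smul_apply, smul_eq_mul, ← ENNReal.ofReal_mul (by positivity),
    inv_mul_cancel_left₀ hRpos.ne']

end

/-! ### Moments of Gaussian measures -/

section

variable {ι κ : Type*} [Fintype ι] [DecidableEq ι] [Fintype κ] [DecidableEq κ]

lemma memLp_eval_multivariateGaussian (m : EuclideanSpace ℝ ι) (V : Matrix ι ι ℝ) (i : ι) :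
    MemLp (fun x : EuclideanSpace ℝ ι => x i) 2 (multivariateGaussian m V) :=
  (EuclideanSpace.proj (𝕜 := ℝ) i).comp_memLp' IsGaussian.memLp_two_id

lemma integrable_eval_multivariateGaussian (m : EuclideanSpace ℝ ι) (V : Matrix ι ι ℝ) (i : ι) :
    Integrable (fun x : EuclideanSpace ℝ ι => x i) (multivariateGaussian m V) :=
  (memLp_eval_multivariateGaussian m V i).integrable (by norm_num)

lemma integrable_mul_multivariateGaussian (m : EuclideanSpace ℝ ι) (V : Matrix ι ι ℝ) (i j : ι) :
    Integrable (fun x : EuclideanSpace ℝ ι => x i * x j) (multivariateGaussian m V) :=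
  (memLp_eval_multivariateGaussian m V i).integrable_mul (memLp_eval_multivariateGaussian m V j)

lemma integral_eval_multivariateGaussian (m : EuclideanSpace ℝ ι) (V : Matrix ι ι ℝ) (i : ι) :
    ∫ x, x i ∂(multivariateGaussian m V) = m i := by
  have h := (EuclideanSpace.proj (𝕜 := ℝ) i).integral_comp_id_comm
    (IsGaussian.integrable_id (μ := multivariateGaussian m V))
  rwa [integral_id_multivariateGaussian] at h

lemma integral_mul_multivariateGaussian (m : EuclideanSpace ℝ ι) {V : Matrix ι ι ℝ}
    (hV : V.PosSemidef) (i j : ι) :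
    ∫ x, x i * x j ∂(multivariateGaussian m V) = V i j + m i * m j := by
  have h := covariance_eval_multivariateGaussian (μ := m) hV i j
  rw [covariance_eq_sub (memLp_eval_multivariateGaussian m V i)
    (memLp_eval_multivariateGaussian m V j), integral_eval_multivariateGaussian,
    integral_eval_multivariateGaussian] at h
  simp only [Pi.mul_apply] at h
  linarith

/-! ### Integrals against a Gaussian density -/

lemma integrable_gaussianDensity_mul_iff (m : EuclideanSpace ℝ ι) {V : Matrix ι ι ℝ}
    (hV : V.PosDef) (f : EuclideanSpace ℝ ι → ℝ) :
    Integrable (fun s => gaussianDensity m V s * f s) ↔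
      Integrable f (multivariateGaussian m V) := by
  rw [← withDensity_gaussianDensity m hV, integrable_withDensity_iff_integrable_smul'
    (continuous_gaussianDensity m V).measurable.ennreal_ofReal (by simp)]
  simp [ENNReal.toReal_ofReal (gaussianDensity_nonneg m V _)]

lemma integral_gaussianDensity_mul (m : EuclideanSpace ℝ ι) {V : Matrix ι ι ℝ}
    (hV : V.PosDef) (f : EuclideanSpace ℝ ι → ℝ) :
    ∫ s, gaussianDensity m V s * f s = ∫ s, f s ∂(multivariateGaussian m V) := by
  rw [← withDensity_gaussianDensity m hV, integral_withDensity_eq_integral_toReal_smul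
    (continuous_gaussianDensity m V).measurable.ennreal_ofReal (by simp)]
  simp [ENNReal.toReal_ofReal (gaussianDensity_nonneg m V _)]

lemma integrable_gaussianDensity (m : EuclideanSpace ℝ ι) {V : Matrix ι ι ℝ} (hV : V.PosDef) :
    Integrable (gaussianDensity m V) := by
  simpa using (integrable_gaussianDensity_mul_iff m hV fun _ => 1).2 (integrable_const _)

lemma integral_gaussianDensity (m : EuclideanSpace ℝ ι) {V : Matrix ι ι ℝ} (hV : V.PosDef) :
    ∫ s, gaussianDensity m V s = 1 := by
  simpa using integral_gaussianDensity_mul m hV fun _ => 1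

/-! ### Completing the square -/

lemma dotProduct_mulVec_transpose {ι κ : Type*} [Fintype ι] [Fintype κ] (A : Matrix ι κ ℝ)
    (u : ι → ℝ) (v : κ → ℝ) : u ⬝ᵥ (A *ᵥ v) = v ⬝ᵥ (Aᵀ *ᵥ u) := by
  rw [dotProduct_mulVec, ← mulVec_transpose, dotProduct_comm]

lemma quadratic_sub_mulVec {ι κ : Type*} [Fintype ι] [Fintype κ] {M : Matrix ι ι ℝ} (hM : Mᵀ = M)
    (A : Matrix ι κ ℝ) (u : ι → ℝ) (v : κ → ℝ) :
    (u - A *ᵥ v) ⬝ᵥ (M *ᵥ (u - A *ᵥ v)) =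
      u ⬝ᵥ (M *ᵥ u) - 2 * (v ⬝ᵥ ((Aᵀ * M) *ᵥ u)) + v ⬝ᵥ ((Aᵀ * M * A) *ᵥ v) := by
  have h1 : u ⬝ᵥ (M *ᵥ (A *ᵥ v)) = v ⬝ᵥ ((Aᵀ * M) *ᵥ u) := by
    rw [mulVec_mulVec, dotProduct_mulVec_transpose, transpose_mul, hM]
  have h2 : (A *ᵥ v) ⬝ᵥ (M *ᵥ u) = v ⬝ᵥ ((Aᵀ * M) *ᵥ u) := by
    rw [← mulVec_mulVec, dotProduct_comm, dotProduct_mulVec_transpose]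
  have h3 : (A *ᵥ v) ⬝ᵥ (M *ᵥ (A *ᵥ v)) = v ⬝ᵥ ((Aᵀ * M * A) *ᵥ v) := by
    rw [← mulVec_mulVec, ← mulVec_mulVec, dotProduct_comm, dotProduct_mulVec_transpose]
  rw [mulVec_sub, sub_dotProduct, dotProduct_sub, dotProduct_sub, h1, h2, h3]
  ring

lemma _root_.Matrix.PosDef.transpose_eq {ι : Type*} {M : Matrix ι ι ℝ} (h : M.PosDef) : Mᵀ = M := by
  simpa [IsHermitian, conjTranspose_eq_transpose_of_trivial] using h.isHermitian

lemma posDef_precision {D : Matrix ι ι ℝ} {W : Matrix κ κ ℝ} (hD : D.PosDef) (hW : W.PosDef)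
    (F : Matrix ι κ ℝ) : (Fᵀ * D⁻¹ * F + W⁻¹).PosDef := by
  have h := hD.inv.posSemidef.conjTranspose_mul_mul_same F
  rw [conjTranspose_eq_transpose_of_trivial] at h
  exact hW.inv.posSemidef_add h

lemma posDef_marginalCov {ι κ : Type*} [Fintype ι] [Fintype κ] {D : Matrix ι ι ℝ}
    {W : Matrix κ κ ℝ} (hD : D.PosDef) (hW : W.PosDef) (F : Matrix ι κ ℝ) : (F * W * Fᵀ + D).PosDef := by
  have h := hW.posSemidef.mul_mul_conjTranspose_same F
  rw [conjTranspose_eq_transpose_of_trivial] at h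
  exact hD.posSemidef_add h

/-- Bayes' rule for a Gaussian linear model: the joint density of `(x, s)` factors into the marginal
density of `x` and the Gaussian posterior density of `s`. The exponents agree by completing the
square (with the Woodbury identity for the inverse of the marginal covariance), the normalizing
constants by the matrix determinant lemma. -/
lemma gaussianDensity_mul_gaussianDensity {D : Matrix ι ι ℝ} {W : Matrix κ κ ℝ} (hD : D.PosDef)
    (hW : W.PosDef) (F : Matrix ι κ ℝ) (x : EuclideanSpace ℝ ι) (s : EuclideanSpace ℝ κ) :
    gaussianDensity (mulE F s) D x * gaussianDensity 0 W s =
      gaussianDensity 0 (F * W * Fᵀ + D) x *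
        gaussianDensity (mulE ((Fᵀ * D⁻¹ * F + W⁻¹)⁻¹ * Fᵀ * D⁻¹) x) (Fᵀ * D⁻¹ * F + W⁻¹)⁻¹ s := by
  set K := Fᵀ * D⁻¹ * F + W⁻¹ with hK
  have hKp : K.PosDef := posDef_precision hD hW F
  have hKu : IsUnit K.det := hKp.det_pos.ne'.isUnit
  have hWu : IsUnit W.det := hW.det_pos.ne'.isUnit
  have hDt : (D⁻¹)ᵀ = D⁻¹ := hD.inv.transpose_eq
  have hKt : (K⁻¹)ᵀ = K⁻¹ := hKp.inv.transpose_eq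
  have hdet : D.det * W.det = (F * W * Fᵀ + D).det * K⁻¹.det := by
    have h1 : (F * W * Fᵀ + D).det = D.det * (K.det * W.det) := by
      rw [add_comm, Matrix.mul_assoc, det_add_mul _ _ hD.det_pos.ne'.isUnit, mul_comm K.det,
        ← det_mul, hK, Matrix.mul_add, mul_nonsing_inv _ hWu, add_comm]
      simp only [Matrix.mul_assoc]
    rw [h1, det_nonsing_inv, Ring.inverse_eq_inv']
    have := hKp.det_pos.ne'
    field_simp
  have hquad : WithLp.ofLp (x - mulE F s) ⬝ᵥ (D⁻¹ *ᵥ WithLp.ofLp (x - mulE F s)) +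
      WithLp.ofLp (s - 0) ⬝ᵥ (W⁻¹ *ᵥ WithLp.ofLp (s - 0)) =
      WithLp.ofLp (x - 0) ⬝ᵥ ((F * W * Fᵀ + D)⁻¹ *ᵥ WithLp.ofLp (x - 0)) +
      WithLp.ofLp (s - mulE (K⁻¹ * Fᵀ * D⁻¹) x) ⬝ᵥ
        ((K⁻¹)⁻¹ *ᵥ WithLp.ofLp (s - mulE (K⁻¹ * Fᵀ * D⁻¹) x)) := by
    have hV : (F * W * Fᵀ + D)⁻¹ = D⁻¹ - D⁻¹ * F * K⁻¹ * Fᵀ * D⁻¹ := by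
      rw [add_comm, add_mul_mul_inv_eq_sub _ _ _ _ hD.isUnit hW.isUnit
        (by rw [add_comm]; exact hKp.isUnit), add_comm W⁻¹]
    have hLt : (K⁻¹ * Fᵀ * D⁻¹)ᵀ = D⁻¹ * F * K⁻¹ := by
      rw [transpose_mul, transpose_mul, transpose_transpose, hDt, hKt, Matrix.mul_assoc]
    simp only [mulE, WithLp.ofLp_sub, sub_zero, nonsing_inv_nonsing_inv _ hKu]
    rw [quadratic_sub_mulVec hDt, quadratic_sub_mulVec hKp.transpose_eq, hLt, hV,
      nonsing_inv_mul_cancel_right _ _ hKu, dotProduct_mulVec_transpose (D⁻¹ * F), transpose_mul,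
      hDt]
    simp only [hK, add_mulVec, sub_mulVec, dotProduct_add, dotProduct_sub, Matrix.mul_assoc]
    ring
  unfold gaussianDensity
  refine (mul_mul_mul_comm _ _ _ _).trans (Eq.trans ?_ (mul_mul_mul_comm _ _ _ _))
  have hDp := hD.det_pos
  have hVp := (posDef_marginalCov hD hW F).det_pos
  rw [← Real.exp_add, ← Real.exp_add, ← mul_add, ← mul_add, hquad, ← mul_inv, ← mul_inv,
    ← Real.sqrt_mul (by positivity), ← Real.sqrt_mul (by positivity), mul_mul_mul_comm, hdet,
    mul_mul_mul_comm _ (F * W * Fᵀ + D).det]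

end

/-! ### The law of a Gaussian linear model -/

section

variable {ι κ : Type*} [Fintype ι] [Fintype κ] [DecidableEq κ]

lemma continuous_gaussianDensity_comp [DecidableEq ι] {α : Type*} [TopologicalSpace α]
    {m x : α → EuclideanSpace ℝ ι}
    (hm : Continuous m) (hx : Continuous x) (V : Matrix ι ι ℝ) :
    Continuous fun a => gaussianDensity (m a) V (x a) := by
  unfold gaussianDensity
  fun_prop

lemma measurePreserving_shear {ι κ : Type*} [Fintype ι] [Fintype κ] (F : Matrix ι κ ℝ) :
    MeasurePreserving fun p : EuclideanSpace ℝ κ × EuclideanSpace ℝ ι =>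
      (mulE F p.1 + p.2, p.1) := by
  have h : MeasurePreserving (fun p : EuclideanSpace ℝ κ × EuclideanSpace ℝ ι =>
      (p.1, mulE F p.1 + p.2)) :=
    (MeasurePreserving.id volume).skew_product (g := fun s e => mulE F s + e)
      (((continuous_mulE F).comp continuous_fst).add continuous_snd).measurable
      (ae_of_all _ fun s => map_add_left_eq_self _ _)
  exact Measure.measurePreserving_swap.comp h

/-- `(X, S)` is the image of `(S, E)` under the shear `(s, e) ↦ (F s + e, s)`, which preserves
Lebesgue measure, so its density is the product density of `(S, E)` in the new variables. -/
lemma map_prodMk_linearModel [DecidableEq ι] {Ω' : Type*} [MeasurableSpace Ω'] {P : Measure Ω'}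
    [IsProbabilityMeasure P] {D : Matrix ι ι ℝ} {W : Matrix κ κ ℝ} (hD : D.PosDef) (hW : W.PosDef)
    (F : Matrix ι κ ℝ) {S : Ω' → EuclideanSpace ℝ κ} {E X : Ω' → EuclideanSpace ℝ ι}
    (hS : HasLaw S (multivariateGaussian 0 W) P) (hE : HasLaw E (multivariateGaussian 0 D) P)
    (hSE : IndepFun S E P) (hX : ∀ ω, X ω = mulE F (S ω) + E ω) :
    P.map (fun ω => (X ω, S ω)) = volume.withDensity fun z =>
      ENNReal.ofReal (gaussianDensity (mulE F z.2) D z.1 * gaussianDensity 0 W z.2) := by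
  set φ : EuclideanSpace ℝ κ × EuclideanSpace ℝ ι → EuclideanSpace ℝ ι × EuclideanSpace ℝ κ :=
    fun p => (mulE F p.1 + p.2, p.1) with hφ
  have hφm : MeasurePreserving φ := measurePreserving_shear F
  have hXS : (fun ω => (X ω, S ω)) = φ ∘ fun ω => (S ω, E ω) := by
    ext1 ω
    simp [hφ, hX]
  have hmeas : Measurable fun z : EuclideanSpace ℝ ι × EuclideanSpace ℝ κ =>
      ENNReal.ofReal (gaussianDensity (mulE F z.2) D z.1 * gaussianDensity 0 W z.2) :=
    ((continuous_gaussianDensity_comp ((continuous_mulE F).comp continuous_snd) continuous_fst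
      D).mul (continuous_gaussianDensity_comp continuous_const continuous_snd
        W)).measurable.ennreal_ofReal
  rw [hXS, ← AEMeasurable.map_map_of_aemeasurable hφm.measurable.aemeasurable
      (hS.aemeasurable.prodMk hE.aemeasurable),
    (indepFun_iff_map_prod_eq_prod_map_map hS.aemeasurable hE.aemeasurable).1 hSE,
    hS.map_eq, hE.map_eq, ← withDensity_gaussianDensity 0 hW, ← withDensity_gaussianDensity 0 hD,
    prod_withDensity (continuous_gaussianDensity _ _).measurable.ennreal_ofReal
      (continuous_gaussianDensity _ _).measurable.ennreal_ofReal, ← hφm.map_eq,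
    ← map_withDensity_comp _ hφm.measurable hmeas]
  congr 2
  ext p
  rw [← ENNReal.ofReal_mul (gaussianDensity_nonneg _ _ _), mul_comm]
  simp [hφ, gaussianDensity]

/-- The Gaussian measures with mean `L y` and positive definite covariance `G`, as a kernel in `y`.
They are given by their densities, which makes the measurability in `y` immediate. -/
noncomputable def gaussianKernel (L : Matrix κ ι ℝ) (G : Matrix κ κ ℝ) :
    Kernel (EuclideanSpace ℝ ι) (EuclideanSpace ℝ κ) :=
  Kernel.withDensity (Kernel.const _ volume)
    fun y s => ENNReal.ofReal (gaussianDensity (mulE L y) G s)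

lemma measurable_gaussianKernel_density (L : Matrix κ ι ℝ) (G : Matrix κ κ ℝ) :
    Measurable (Function.uncurry fun (y : EuclideanSpace ℝ ι) (s : EuclideanSpace ℝ κ) =>
      ENNReal.ofReal (gaussianDensity (mulE L y) G s)) :=
  (continuous_gaussianDensity_comp ((continuous_mulE L).comp continuous_fst) continuous_snd
    G).measurable.ennreal_ofReal

lemma gaussianKernel_apply (L : Matrix κ ι ℝ) {G : Matrix κ κ ℝ} (hG : G.PosDef)
    (y : EuclideanSpace ℝ ι) :
    gaussianKernel L G y = multivariateGaussian (mulE L y) G := by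
  rw [gaussianKernel, Kernel.withDensity_apply _ (measurable_gaussianKernel_density L G),
    Kernel.const_apply, withDensity_gaussianDensity _ hG]

lemma isMarkovKernel_gaussianKernel (L : Matrix κ ι ℝ) {G : Matrix κ κ ℝ} (hG : G.PosDef) :
    IsMarkovKernel (gaussianKernel L G) :=
  ⟨fun y => by rw [gaussianKernel_apply L hG]; infer_instance⟩

lemma withDensity_mul_eq_compProd [DecidableEq ι] {V : Matrix ι ι ℝ} (hV : V.PosDef)
    (L : Matrix κ ι ℝ) {G : Matrix κ κ ℝ} (hG : G.PosDef) :
    (volume.withDensity fun z : EuclideanSpace ℝ ι × EuclideanSpace ℝ κ =>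
      ENNReal.ofReal (gaussianDensity 0 V z.1 * gaussianDensity (mulE L z.1) G z.2)) =
      multivariateGaussian 0 V ⊗ₘ gaussianKernel L G := by
  have := isMarkovKernel_gaussianKernel L hG
  have hm := measurable_gaussianKernel_density L G
  have hV1 : Measurable fun y => ENNReal.ofReal (gaussianDensity 0 V y) :=
    (continuous_gaussianDensity 0 V).measurable.ennreal_ofReal
  ext t ht
  rw [Measure.compProd_apply ht, ← withDensity_gaussianDensity 0 hV,
    lintegral_withDensity_eq_lintegral_mul _ hV1 (Kernel.measurable_kernel_prodMk_left ht),
    withDensity_apply _ ht, ← lintegral_indicator ht, Measure.volume_eq_prod, lintegral_prod]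
  · refine lintegral_congr fun y => ?_
    rw [Pi.mul_apply, gaussianKernel, Kernel.withDensity_apply' _ hm, Kernel.const_apply,
      ← lintegral_indicator (measurable_prodMk_left ht), ← lintegral_const_mul]
    · refine lintegral_congr fun s => ?_
      by_cases hs : (y, s) ∈ t
      · rw [Set.indicator_of_mem hs, Set.indicator_of_mem (Set.mem_preimage.2 hs),
          ENNReal.ofReal_mul (gaussianDensity_nonneg _ _ _)]
      · rw [Set.indicator_of_notMem hs, Set.indicator_of_notMem (by simpa using hs), mul_zero]
    · exact (hm.comp measurable_prodMk_left).indicator (measurable_prodMk_left ht)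
  · refine AEMeasurable.indicator (Measurable.aemeasurable ?_) ht
    simp_rw [ENNReal.ofReal_mul (gaussianDensity_nonneg 0 V _)]
    exact (hV1.comp measurable_fst).mul hm

end

section

variable {n n₁ n₂ : ℕ} {θ : Params n n₁ n₂}

lemma Params.Admissible.posDef_Dmat (hθ : θ.Admissible) : θ.Dmat.PosDef :=
  PosDef.diagonal hθ.2

lemma Params.Admissible.posDef_Ωtilde (hθ : θ.Admissible) : θ.Ωtilde.PosDef := by
  have := hθ.1.isUnit.invertible
  unfold Params.Ωtilde
  refine PosDef.of_dotProduct_mulVec_pos ?_ fun v hv => ?_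
  · exact isHermitian_fromBlocks_iff.2 ⟨hθ.1.isHermitian, by simp, by simp, isHermitian_one⟩
  · obtain ⟨a, b, rfl⟩ : ∃ a b, v = Sum.elim a b := ⟨_, _, (Sum.elim_comp_inl_inr v).symm⟩
    have hs : (Sum.elim a b) ⬝ᵥ (fromBlocks θ.Ω 0 0 1 *ᵥ Sum.elim a b) =
        a ⬝ᵥ (θ.Ω *ᵥ a) + b ⬝ᵥ b := by
      simp [fromBlocks_mulVec, dotProduct, Fintype.sum_sum_type]
    rw [star_trivial, hs]
    by_cases ha : a = 0
    · have hb : b ≠ 0 := by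
        rintro rfl
        exact hv (by ext i; cases i <;> simp [ha])
      have := dotProduct_star_self_pos_iff.2 hb
      rw [star_trivial] at this
      simpa [ha] using this
    · have h1 := hθ.1.dotProduct_mulVec_pos ha
      have h2 := dotProduct_star_self_nonneg b
      rw [star_trivial] at h1 h2
      linarith

lemma Params.Admissible.posDef_modelCov (hθ : θ.Admissible) (F₁ : Matrix (Fin n) (Fin n₁) ℝ) :
    (modelCov F₁ θ).PosDef :=
  posDef_marginalCov hθ.posDef_Dmat hθ.posDef_Ωtilde _

lemma Params.Admissible.posDef_postCov (hθ : θ.Admissible) (F₁ : Matrix (Fin n) (Fin n₁) ℝ) :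
    (postCov F₁ θ).PosDef :=
  (posDef_precision hθ.posDef_Dmat hθ.posDef_Ωtilde _).inv

lemma returnDensity_pos (hθ : θ.Admissible) (F₁ : Matrix (Fin n) (Fin n₁) ℝ)
    (y : EuclideanSpace ℝ (Fin n)) : 0 < returnDensity F₁ θ y :=
  gaussianDensity_pos _ (hθ.posDef_modelCov F₁) _

lemma jointDensity_pos (hθ : θ.Admissible) (F₁ : Matrix (Fin n) (Fin n₁) ℝ)
    (y : EuclideanSpace ℝ (Fin n)) (s : EuclideanSpace ℝ (Fin n₁ ⊕ Fin n₂)) :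
    0 < jointDensity F₁ θ y s :=
  mul_pos (gaussianDensity_pos _ hθ.posDef_Dmat _) (gaussianDensity_pos _ hθ.posDef_Ωtilde _)

lemma jointDensity_eq (hθ : θ.Admissible) (F₁ : Matrix (Fin n) (Fin n₁) ℝ)
    (y : EuclideanSpace ℝ (Fin n)) (s : EuclideanSpace ℝ (Fin n₁ ⊕ Fin n₂)) :
    jointDensity F₁ θ y s = returnDensity F₁ θ y *
      gaussianDensity (mulE (postGain F₁ θ) y) (postCov F₁ θ) s :=
  gaussianDensity_mul_gaussianDensity hθ.posDef_Dmat hθ.posDef_Ωtilde _ _ _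

lemma condDensity_eq (hθ : θ.Admissible) (F₁ : Matrix (Fin n) (Fin n₁) ℝ)
    (y : EuclideanSpace ℝ (Fin n)) (s : EuclideanSpace ℝ (Fin n₁ ⊕ Fin n₂)) :
    condDensity F₁ θ y s = gaussianDensity (mulE (postGain F₁ θ) y) (postCov F₁ θ) s := by
  rw [condDensity, jointDensity_eq hθ, mul_div_cancel_left₀ _ (returnDensity_pos hθ F₁ y).ne']

lemma integrable_jointDensity (hθ : θ.Admissible) (F₁ : Matrix (Fin n) (Fin n₁) ℝ)
    (y : EuclideanSpace ℝ (Fin n)) : Integrable fun s => jointDensity F₁ θ y s := by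
  simp_rw [jointDensity_eq hθ]
  exact (integrable_gaussianDensity _ (hθ.posDef_postCov F₁)).const_mul _

lemma integral_jointDensity (hθ : θ.Admissible) (F₁ : Matrix (Fin n) (Fin n₁) ℝ)
    (y : EuclideanSpace ℝ (Fin n)) : ∫ s, jointDensity F₁ θ y s = returnDensity F₁ θ y := by
  simp_rw [jointDensity_eq hθ]
  rw [integral_const_mul, integral_gaussianDensity _ (hθ.posDef_postCov F₁), mul_one]

lemma withDensity_condDensity (hθ : θ.Admissible) (F₁ : Matrix (Fin n) (Fin n₁) ℝ)
    (y : EuclideanSpace ℝ (Fin n)) :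
    (volume.withDensity fun s => ENNReal.ofReal (condDensity F₁ θ y s)) =
      multivariateGaussian (mulE (postGain F₁ θ) y) (postCov F₁ θ) := by
  simp_rw [condDensity_eq hθ]
  exact withDensity_gaussianDensity _ (hθ.posDef_postCov F₁)

/-- The joint law, the law of the returns and the posterior of the factors: the joint density
factors into the marginal density and the posterior kernel, which is therefore a version of the
conditional distribution. -/
lemma model_laws (hθ : θ.Admissible) (F₁ : Matrix (Fin n) (Fin n₁) ℝ)
    {Ω' : Type*} [MeasurableSpace Ω'] {P : Measure Ω'} [IsProbabilityMeasure P]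
    {S : Ω' → EuclideanSpace ℝ (Fin n₁ ⊕ Fin n₂)} {E X : Ω' → EuclideanSpace ℝ (Fin n)}
    (hS : HasLaw S (multivariateGaussian 0 θ.Ωtilde) P)
    (hE : HasLaw E (multivariateGaussian 0 θ.Dmat) P)
    (hSE : IndepFun S E P) (hX : ∀ ω, X ω = mulE (θ.Ftilde F₁) (S ω) + E ω) :
    HasLaw X (multivariateGaussian 0 (modelCov F₁ θ)) P ∧
    HasLaw (fun ω => (X ω, S ω)) (volume.withDensity fun z =>
      ENNReal.ofReal (jointDensity F₁ θ z.1 z.2)) P ∧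
    condDistrib S X P =ᵐ[P.map X] fun y =>
      multivariateGaussian (mulE (postGain F₁ θ) y) (postCov F₁ θ) := by
  have hG := hθ.posDef_postCov F₁
  have := isMarkovKernel_gaussianKernel (postGain F₁ θ) hG
  have hXm : AEMeasurable X P := by
    rw [funext hX]
    exact ((continuous_mulE _).measurable.comp_aemeasurable hS.aemeasurable).add hE.aemeasurable
  have hjoint : P.map (fun ω => (X ω, S ω)) = volume.withDensity fun z =>
      ENNReal.ofReal (jointDensity F₁ θ z.1 z.2) :=
    map_prodMk_linearModel hθ.posDef_Dmat hθ.posDef_Ωtilde _ hS hE hSE hX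
  have hcomp : P.map (fun ω => (X ω, S ω)) =
      multivariateGaussian 0 (modelCov F₁ θ) ⊗ₘ gaussianKernel (postGain F₁ θ) (postCov F₁ θ) := by
    rw [hjoint, ← withDensity_mul_eq_compProd (hθ.posDef_modelCov F₁) _ hG]
    simp_rw [jointDensity_eq hθ]
    rfl
  have hmap : P.map X = multivariateGaussian 0 (modelCov F₁ θ) := by
    rw [← Measure.fst_compProd (multivariateGaussian 0 (modelCov F₁ θ))
      (gaussianKernel (postGain F₁ θ) (postCov F₁ θ)), ← hcomp,
      Measure.fst_map_prodMk₀ hS.aemeasurable]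
  refine ⟨⟨hXm, hmap⟩, ⟨hXm.prodMk hS.aemeasurable, hjoint⟩, ?_⟩
  have hcond := condDistrib_ae_eq_of_measure_eq_compProd X hS.aemeasurable
    (hmap.symm ▸ hcomp)
  filter_upwards [hcond] with y hy
  rw [hy, gaussianKernel_apply _ hG]

end

/-! ### A calculus of means -/

/-- `f` is `μ`-integrable with integral `v`. -/
structure HasMean {α : Type*} [MeasurableSpace α] (μ : Measure α) (f : α → ℝ) (v : ℝ) : Prop where
  integrable : Integrable f μ
  integral_eq : ∫ a, f a ∂μ = v

namespace HasMean

variable {α : Type*} [MeasurableSpace α] {μ : Measure α} {f g : α → ℝ} {u v : ℝ}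

lemma const [IsProbabilityMeasure μ] (c : ℝ) : HasMean μ (fun _ => c) c :=
  ⟨integrable_const _, by simp⟩

lemma add (hf : HasMean μ f u) (hg : HasMean μ g v) : HasMean μ (fun a => f a + g a) (u + v) :=
  ⟨hf.1.add hg.1, by rw [integral_add hf.1 hg.1, hf.2, hg.2]⟩

lemma sub (hf : HasMean μ f u) (hg : HasMean μ g v) : HasMean μ (fun a => f a - g a) (u - v) :=
  ⟨hf.1.sub hg.1, by rw [integral_sub hf.1 hg.1, hf.2, hg.2]⟩

lemma const_mul (c : ℝ) (hf : HasMean μ f u) : HasMean μ (fun a => c * f a) (c * u) :=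
  ⟨hf.1.const_mul c, by rw [integral_const_mul, hf.2]⟩

lemma sum {β : Type*} [Fintype β] {f : β → α → ℝ} {u : β → ℝ} (hf : ∀ b, HasMean μ (f b) (u b)) :
    HasMean μ (fun a => ∑ b, f b a) (∑ b, u b) :=
  ⟨integrable_finsetSum _ fun b _ => (hf b).1, by
    rw [integral_finsetSum _ fun b _ => (hf b).1]
    exact Finset.sum_congr rfl fun b _ => (hf b).2⟩

lemma sum_sum_mul {β : Type*} [Fintype β] {f : β → β → α → ℝ} {u : β → β → ℝ}
    (c : β → β → ℝ) (hf : ∀ b d, HasMean μ (f b d) (u b d)) :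
    HasMean μ (fun a => ∑ b, ∑ d, c b d * f b d a) (∑ b, ∑ d, c b d * u b d) :=
  .sum fun b => .sum fun d => .const_mul _ (hf b d)

end HasMean

section

variable {ι : Type*} [Fintype ι] [DecidableEq ι]

lemma hasMean_eval_multivariateGaussian (m : EuclideanSpace ℝ ι) (V : Matrix ι ι ℝ) (i : ι) :
    HasMean (multivariateGaussian m V) (fun x => x i) (m i) :=
  ⟨integrable_eval_multivariateGaussian m V i, integral_eval_multivariateGaussian m V i⟩

lemma hasMean_mul_multivariateGaussian (m : EuclideanSpace ℝ ι) {V : Matrix ι ι ℝ}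
    (hV : V.PosSemidef) (i j : ι) :
    HasMean (multivariateGaussian m V) (fun x => x i * x j) (V i j + m i * m j) :=
  ⟨integrable_mul_multivariateGaussian m V i j, integral_mul_multivariateGaussian m hV i j⟩

end

variable {n n₁ n₂ T : ℕ} {θ θk : Params n n₁ n₂}

lemma mulE_apply {ι κ : Type*} [Fintype κ] (A : Matrix ι κ ℝ) (v : EuclideanSpace ℝ κ) (i : ι) :
    mulE A v i = ∑ j, A i j * v j := rfl

/-- `μ` is a probability measure whose matrix of (uncentered) second moments is `C`. -/
structure HasSecondMoment (μ : Measure (EuclideanSpace ℝ (Fin n))) (C : Matrix (Fin n) (Fin n) ℝ) :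
    Prop where
  isProbabilityMeasure : IsProbabilityMeasure μ
  hasMean_mul : ∀ i j, HasMean μ (fun y => y i * y j) (C i j)

namespace HasSecondMoment

variable {μ : Measure (EuclideanSpace ℝ (Fin n))} {C : Matrix (Fin n) (Fin n) ℝ} {κ : Type*}

lemma hasMean_eval_mul_mulE (h : HasSecondMoment μ C) (L : Matrix κ (Fin n) ℝ) (i : Fin n)
    (a : κ) : HasMean μ (fun y => y i * mulE L y a) ((C * Lᵀ) i a) := by
  have h1 := HasMean.sum fun j => (h.hasMean_mul i j).const_mul (L a j)
  simpa [mulE_apply, Finset.mul_sum, mul_left_comm, Matrix.mul_apply, mul_comm (C i _)] using h1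

lemma hasMean_mulE_mul_mulE (h : HasSecondMoment μ C) (L : Matrix κ (Fin n) ℝ) (a b : κ) :
    HasMean μ (fun y => mulE L y a * mulE L y b) ((L * C * Lᵀ) a b) := by
  have h1 := HasMean.sum fun i => (h.hasMean_eval_mul_mulE L i b).const_mul (L a i)
  rw [Matrix.mul_assoc, Matrix.mul_apply]
  simpa [mulE_apply L _ a, Finset.sum_mul, mul_assoc] using h1

/-- The average of the posterior second moments `E[s sᵀ | y] = G + (L y)(L y)ᵀ` is `C_ss`. -/
lemma hasMean_Css (h : HasSecondMoment μ C) (F₁ : Matrix (Fin n) (Fin n₁) ℝ)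
    (θ : Params n n₁ n₂) (a b : Fin n₁ ⊕ Fin n₂) :
    HasMean μ (fun y => postCov F₁ θ a b + mulE (postGain F₁ θ) y a * mulE (postGain F₁ θ) y b)
      (Css F₁ C θ a b) :=
  have := h.isProbabilityMeasure
  .add (.const _) (h.hasMean_mulE_mul_mulE _ a b)

end HasSecondMoment

lemma secondMoment_apply (x : Fin T → EuclideanSpace ℝ (Fin n)) (w : Fin T → ℝ) (i j : Fin n) :
    secondMoment x w i j = ∑ τ, w τ * (x τ i * x τ j) := by
  simp [secondMoment, Matrix.sum_apply, vecMulVec_apply]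

lemma posSemidef_secondMoment (x : Fin T → EuclideanSpace ℝ (Fin n)) {w : Fin T → ℝ}
    (hw : ∀ τ, 0 ≤ w τ) : (secondMoment x w).PosSemidef :=
  posSemidef_sum _ fun τ _ => by
    simpa using (posSemidef_vecMulVec_self_star (WithLp.ofLp (x τ))).smul (hw τ)

/-- The weighted sample as a discrete measure. -/
noncomputable def sampleMeasure (x : Fin T → EuclideanSpace ℝ (Fin n)) (w : Fin T → ℝ) :
    Measure (EuclideanSpace ℝ (Fin n)) :=
  ∑ τ, ENNReal.ofReal (w τ) • Measure.dirac (x τ)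

lemma hasMean_sampleMeasure (x : Fin T → EuclideanSpace ℝ (Fin n)) {w : Fin T → ℝ}
    (hw : ∀ τ, 0 ≤ w τ) (f : EuclideanSpace ℝ (Fin n) → ℝ) :
    HasMean (sampleMeasure x w) f (∑ τ, w τ * f (x τ)) := by
  have h (τ : Fin T) : Integrable f (ENNReal.ofReal (w τ) • Measure.dirac (x τ)) :=
    (integrable_dirac (by simp)).smul_measure (by simp)
  refine ⟨integrable_finsetSum_measure.2 fun τ _ => h τ, ?_⟩
  rw [sampleMeasure, integral_finsetSum_measure fun τ _ => h τ]
  simp [integral_smul_measure, ENNReal.toReal_ofReal (hw _)]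

lemma hasSecondMoment_sampleMeasure (x : Fin T → EuclideanSpace ℝ (Fin n)) {w : Fin T → ℝ}
    (hw : ∀ τ, 0 ≤ w τ) (hw1 : ∑ τ, w τ = 1) :
    HasSecondMoment (sampleMeasure x w) (secondMoment x w) where
  isProbabilityMeasure := ⟨by
    simp [sampleMeasure, ← ENNReal.ofReal_sum_of_nonneg fun τ _ => hw τ, hw1]⟩
  hasMean_mul i j := by
    rw [secondMoment_apply]
    exact hasMean_sampleMeasure x hw _

lemma hasSecondMoment_multivariateGaussian {C : Matrix (Fin n) (Fin n) ℝ} (hC : C.PosSemidef) :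
    HasSecondMoment (multivariateGaussian 0 C) C where
  isProbabilityMeasure := inferInstance
  hasMean_mul i j := by simpa using hasMean_mul_multivariateGaussian 0 hC i j

/-! ### Posterior moments -/

lemma integrable_condDensity_mul_iff (hθ : θ.Admissible) (F₁ : Matrix (Fin n) (Fin n₁) ℝ)
    (y : EuclideanSpace ℝ (Fin n)) (f : EuclideanSpace ℝ (Fin n₁ ⊕ Fin n₂) → ℝ) :
    Integrable (fun s => condDensity F₁ θ y s * f s) ↔
      Integrable f (multivariateGaussian (mulE (postGain F₁ θ) y) (postCov F₁ θ)) := by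
  simp_rw [condDensity_eq hθ]
  exact integrable_gaussianDensity_mul_iff _ (hθ.posDef_postCov F₁) f

lemma integral_condDensity_mul (hθ : θ.Admissible) (F₁ : Matrix (Fin n) (Fin n₁) ℝ)
    (y : EuclideanSpace ℝ (Fin n)) (f : EuclideanSpace ℝ (Fin n₁ ⊕ Fin n₂) → ℝ) :
    ∫ s, condDensity F₁ θ y s * f s =
      ∫ s, f s ∂(multivariateGaussian (mulE (postGain F₁ θ) y) (postCov F₁ θ)) := by
  simp_rw [condDensity_eq hθ]
  exact integral_gaussianDensity_mul _ (hθ.posDef_postCov F₁) f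

lemma Css_eq_sum_integral (hθ : θ.Admissible) (F₁ : Matrix (Fin n) (Fin n₁) ℝ)
    (x : Fin T → EuclideanSpace ℝ (Fin n)) {w : Fin T → ℝ} (hw : ∀ τ, 0 ≤ w τ)
    (hw1 : ∑ τ, w τ = 1) (a b : Fin n₁ ⊕ Fin n₂) :
    Css F₁ (secondMoment x w) θ a b =
      ∑ τ, w τ * ∫ s, condDensity F₁ θ (x τ) s * (s a * s b) := by
  simp_rw [integral_condDensity_mul hθ,
    integral_mul_multivariateGaussian _ (hθ.posDef_postCov F₁).posSemidef]
  rw [← ((hasSecondMoment_sampleMeasure x hw hw1).hasMean_Css F₁ θ a b).integral_eq,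
    (hasMean_sampleMeasure x hw _).integral_eq]

lemma Cxs_eq_sum_integral (hθ : θ.Admissible) (F₁ : Matrix (Fin n) (Fin n₁) ℝ)
    (x : Fin T → EuclideanSpace ℝ (Fin n)) {w : Fin T → ℝ} (hw : ∀ τ, 0 ≤ w τ)
    (hw1 : ∑ τ, w τ = 1) (i : Fin n) (a : Fin n₁ ⊕ Fin n₂) :
    Cxs F₁ (secondMoment x w) θ i a =
      ∑ τ, w τ * ∫ s, condDensity F₁ θ (x τ) s * (x τ i * s a) := by
  simp_rw [integral_condDensity_mul hθ, integral_const_mul, integral_eval_multivariateGaussian]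
  rw [Cxs, ← ((hasSecondMoment_sampleMeasure x hw hw1).hasMean_eval_mul_mulE
    (postGain F₁ θ) i a).integral_eq, (hasMean_sampleMeasure x hw _).integral_eq]

/-! ### Expected log-densities -/

/-- `log √((2π)ᵈ det V)`, minus the logarithm of the constant factor in the density of `N(m, V)`. -/
noncomputable def logNormalizer {ι : Type*} [Fintype ι] [DecidableEq ι] (V : Matrix ι ι ℝ) : ℝ :=
  1 / 2 * (Fintype.card ι * Real.log (2 * Real.pi) + Real.log V.det)

lemma log_gaussianDensity {ι : Type*} [Fintype ι] [DecidableEq ι] (m : EuclideanSpace ℝ ι)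
    {V : Matrix ι ι ℝ} (hV : V.PosDef) (x : EuclideanSpace ℝ ι) :
    Real.log (gaussianDensity m V x) =
      -logNormalizer V - 1 / 2 * ∑ i, ∑ j, V⁻¹ i j * ((x i - m i) * (x j - m j)) := by
  have h1 := sqrt_det_factor_pos hV
  have h2 := hV.det_pos
  rw [gaussianDensity, Real.log_mul (by positivity) (by positivity), Real.log_inv, Real.log_exp,
    Real.log_sqrt (by positivity), Real.log_mul (by positivity) (by positivity), Real.log_pow,
    logNormalizer]
  have h3 : WithLp.ofLp (x - m) ⬝ᵥ (V⁻¹ *ᵥ WithLp.ofLp (x - m)) =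
      ∑ i, ∑ j, V⁻¹ i j * ((x i - m i) * (x j - m j)) := by
    simp only [dotProduct, mulVec, Finset.mul_sum]
    exact Finset.sum_congr rfl fun i _ => Finset.sum_congr rfl fun j _ => by
      simp only [WithLp.ofLp_sub, Pi.sub_apply]; ring
  rw [h3]
  ring

lemma log_jointDensity (hθ : θ.Admissible) (F₁ : Matrix (Fin n) (Fin n₁) ℝ)
    (y : EuclideanSpace ℝ (Fin n)) (s : EuclideanSpace ℝ (Fin n₁ ⊕ Fin n₂)) :
    Real.log (jointDensity F₁ θ y s) =
      -logNormalizer θ.Dmat - logNormalizer θ.Ωtilde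
      - 1 / 2 * ∑ i, (θ.D i)⁻¹ * (y i * y i - 2 * ∑ a, θ.Ftilde F₁ i a * (y i * s a) +
          ∑ a, ∑ b, θ.Ftilde F₁ i a * θ.Ftilde F₁ i b * (s a * s b))
      - 1 / 2 * ∑ a, ∑ b, θ.Ωtilde⁻¹ a b * (s a * s b) := by
  rw [jointDensity, Real.log_mul (gaussianDensity_pos _ hθ.posDef_Dmat _).ne'
    (gaussianDensity_pos _ hθ.posDef_Ωtilde _).ne', log_gaussianDensity _ hθ.posDef_Dmat,
    log_gaussianDensity _ hθ.posDef_Ωtilde]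
  have hinv : θ.Dmat⁻¹ = Matrix.diagonal fun i => (θ.D i)⁻¹ := by
    refine Matrix.inv_eq_right_inv ?_
    rw [Params.Dmat, diagonal_mul_diagonal, ← diagonal_one]
    congr 1
    ext i
    exact mul_inv_cancel₀ (hθ.2 i).ne'
  have h (i : Fin n) : ∑ j, θ.Dmat⁻¹ i j *
      ((y i - mulE (θ.Ftilde F₁) s i) * (y j - mulE (θ.Ftilde F₁) s j)) =
      (θ.D i)⁻¹ * (y i * y i - 2 * ∑ a, θ.Ftilde F₁ i a * (y i * s a) +
          ∑ a, ∑ b, θ.Ftilde F₁ i a * θ.Ftilde F₁ i b * (s a * s b)) := by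
    rw [hinv, Finset.sum_eq_single i (fun j _ hj => by simp [diagonal_apply_ne _ hj.symm])
      (by simp), diagonal_apply_eq, mulE_apply]
    have h1 : ∑ a, θ.Ftilde F₁ i a * (y i * s a) = y i * ∑ a, θ.Ftilde F₁ i a * s a := by
      rw [Finset.mul_sum]; exact Finset.sum_congr rfl fun a _ => by ring
    have h2 : ∑ a, ∑ b, θ.Ftilde F₁ i a * θ.Ftilde F₁ i b * (s a * s b) =
        (∑ a, θ.Ftilde F₁ i a * s a) * ∑ a, θ.Ftilde F₁ i a * s a := by
      rw [Finset.sum_mul_sum]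
      exact Finset.sum_congr rfl fun a _ => Finset.sum_congr rfl fun b _ => by ring
    rw [h1, h2]
    ring
  simp_rw [h]
  simp only [PiLp.zero_apply, sub_zero]
  ring

/-- The expected complete-data log-density in terms of the posterior mean `L y` and the posterior
second moments `G + (L y)(L y)ᵀ`. -/
lemma hasMean_log_jointDensity (hθ : θ.Admissible) (hθk : θk.Admissible)
    (F₁ : Matrix (Fin n) (Fin n₁) ℝ) (y : EuclideanSpace ℝ (Fin n)) :
    HasMean (multivariateGaussian (mulE (postGain F₁ θk) y) (postCov F₁ θk))
      (fun s => Real.log (jointDensity F₁ θ y s))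
      (-logNormalizer θ.Dmat - logNormalizer θ.Ωtilde
      - 1 / 2 * ∑ i, (θ.D i)⁻¹ * (y i * y i -
          2 * ∑ a, θ.Ftilde F₁ i a * (y i * mulE (postGain F₁ θk) y a) +
          ∑ a, ∑ b, θ.Ftilde F₁ i a * θ.Ftilde F₁ i b *
            (postCov F₁ θk a b + mulE (postGain F₁ θk) y a * mulE (postGain F₁ θk) y b))
      - 1 / 2 * ∑ a, ∑ b, θ.Ωtilde⁻¹ a b *
          (postCov F₁ θk a b + mulE (postGain F₁ θk) y a * mulE (postGain F₁ θk) y b)) := by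
  rw [funext (log_jointDensity hθ F₁ y)]
  have h1 := hasMean_eval_multivariateGaussian (mulE (postGain F₁ θk) y) (postCov F₁ θk)
  have h2 := hasMean_mul_multivariateGaussian (mulE (postGain F₁ θk) y)
    (hθk.posDef_postCov F₁).posSemidef
  exact .sub (.sub (.const _) (.const_mul _ (.sum fun i => .const_mul _ (.add (.sub (.const _)
    (.const_mul _ (.sum fun a => .const_mul _ (.const_mul _ (h1 a))))) (.sum_sum_mul _ h2)))))
    (.const_mul _ (.sum_sum_mul _ h2))

lemma integrable_condDensity_mul_log_jointDensity (hθ : θ.Admissible) (hθk : θk.Admissible)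
    (F₁ : Matrix (Fin n) (Fin n₁) ℝ) (y : EuclideanSpace ℝ (Fin n)) :
    Integrable fun s => condDensity F₁ θk y s * Real.log (jointDensity F₁ θ y s) :=
  (integrable_condDensity_mul_iff hθk F₁ y _).2 (hasMean_log_jointDensity hθ hθk F₁ y).integrable

/-- The M-step objective as a function of `C`, `C_xs` and `C_ss`. -/
noncomputable def Qmoments (F₁ : Matrix (Fin n) (Fin n₁) ℝ) (C : Matrix (Fin n) (Fin n) ℝ)
    (θ θk : Params n n₁ n₂) : ℝ :=
  -logNormalizer θ.Dmat - logNormalizer θ.Ωtilde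
    - 1 / 2 * ∑ i, (θ.D i)⁻¹ * (C i i - 2 * ∑ a, θ.Ftilde F₁ i a * Cxs F₁ C θk i a +
        ∑ a, ∑ b, θ.Ftilde F₁ i a * θ.Ftilde F₁ i b * Css F₁ C θk a b)
    - 1 / 2 * ∑ a, ∑ b, θ.Ωtilde⁻¹ a b * Css F₁ C θk a b

/-- The average of the expected log-density depends on the distribution of the returns only through
its second moments, because the expected log-density is a quadratic function of the returns
without linear term. -/
lemma HasSecondMoment.hasMean_expectedLogJoint {μ : Measure (EuclideanSpace ℝ (Fin n))}
    {C : Matrix (Fin n) (Fin n) ℝ} (h : HasSecondMoment μ C) (hθ : θ.Admissible)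
    (hθk : θk.Admissible) (F₁ : Matrix (Fin n) (Fin n₁) ℝ) :
    HasMean μ (expectedLogJoint F₁ θ θk) (Qmoments F₁ C θ θk) := by
  have := h.isProbabilityMeasure
  have heq (y : EuclideanSpace ℝ (Fin n)) := (integral_condDensity_mul hθk F₁ y
    (fun s => Real.log (jointDensity F₁ θ y s))).trans
      (hasMean_log_jointDensity hθ hθk F₁ y).integral_eq
  rw [show expectedLogJoint F₁ θ θk = _ from funext heq]
  have h2 := h.hasMean_Css F₁ θk
  exact .sub (.sub (.const _) (.const_mul _ (.sum fun i => .const_mul _ (.add (.sub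
    (h.hasMean_mul i i) (.const_mul _ (.sum fun a => .const_mul _
      (h.hasMean_eval_mul_mulE (postGain F₁ θk) i a)))) (.sum_sum_mul _ h2)))))
    (.const_mul _ (.sum_sum_mul _ h2))

lemma HasSecondMoment.hasMean_log_returnDensity {μ : Measure (EuclideanSpace ℝ (Fin n))}
    {C : Matrix (Fin n) (Fin n) ℝ} (h : HasSecondMoment μ C) (hθ : θ.Admissible)
    (F₁ : Matrix (Fin n) (Fin n₁) ℝ) :
    HasMean μ (fun y => Real.log (returnDensity F₁ θ y))
      (-logNormalizer (modelCov F₁ θ) - 1 / 2 * ∑ i, ∑ j, (modelCov F₁ θ)⁻¹ i j * C i j) := by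
  have := h.isProbabilityMeasure
  simp only [returnDensity, log_gaussianDensity _ (hθ.posDef_modelCov F₁), PiLp.zero_apply,
    sub_zero]
  exact .sub (.const _) (.const_mul _ (.sum_sum_mul _ h.hasMean_mul))

lemma Qweighted_eq (hθ : θ.Admissible) (hθk : θk.Admissible)
    (F₁ : Matrix (Fin n) (Fin n₁) ℝ) (x : Fin T → EuclideanSpace ℝ (Fin n)) {w : Fin T → ℝ}
    (hw : ∀ τ, 0 ≤ w τ) (hw1 : ∑ τ, w τ = 1) :
    Qweighted F₁ x w θ θk = Qmoments F₁ (secondMoment x w) θ θk := by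
  rw [← ((hasSecondMoment_sampleMeasure x hw hw1).hasMean_expectedLogJoint hθ hθk F₁).integral_eq,
    (hasMean_sampleMeasure x hw _).integral_eq, Qweighted]

lemma Qgaussian_eq (hθ : θ.Admissible) (hθk : θk.Admissible)
    (F₁ : Matrix (Fin n) (Fin n₁) ℝ) {C : Matrix (Fin n) (Fin n) ℝ} (hC : C.PosSemidef) :
    Qgaussian F₁ C θ θk = Qmoments F₁ C θ θk :=
  ((hasSecondMoment_multivariateGaussian hC).hasMean_expectedLogJoint hθ hθk F₁).integral_eq

lemma expLogLik_eq_logLik (hθ : θ.Admissible) (F₁ : Matrix (Fin n) (Fin n₁) ℝ)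
    (x : Fin T → EuclideanSpace ℝ (Fin n)) {w : Fin T → ℝ} (hw : ∀ τ, 0 ≤ w τ)
    (hw1 : ∑ τ, w τ = 1) : expLogLik F₁ (secondMoment x w) θ = logLik F₁ x w θ := by
  rw [expLogLik, ((hasSecondMoment_multivariateGaussian
      (posSemidef_secondMoment x hw)).hasMean_log_returnDensity hθ F₁).integral_eq,
    ← ((hasSecondMoment_sampleMeasure x hw hw1).hasMean_log_returnDensity hθ F₁).integral_eq,
    (hasMean_sampleMeasure x hw _).integral_eq, logLik]

/-! ### The log-determinant inequality -/

section

variable {ι : Type*} [Fintype ι] [DecidableEq ι]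

lemma log_det_lt_trace_sub_card {B : Matrix ι ι ℝ} (hB : B.PosDef) (h1 : B ≠ 1) :
    Real.log B.det < B.trace - Fintype.card ι := by
  have hdet := hB.isHermitian.det_eq_prod_eigenvalues
  have htr := hB.isHermitian.trace_eq_sum_eigenvalues
  have hpos := hB.eigenvalues_pos
  set e := hB.isHermitian.eigenvalues with he
  simp only [RCLike.ofReal_real_eq_id, id] at hdet htr
  have hcard : (Fintype.card ι : ℝ) = ∑ _i : ι, (1 : ℝ) := by simp
  rw [hdet, htr, Real.log_prod fun i _ => (hpos i).ne', hcard, ← Finset.sum_sub_distrib]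
  obtain ⟨i, hi⟩ : ∃ i, e i ≠ 1 := by
    by_contra! hall
    apply h1
    have hs := hB.isHermitian.spectral_theorem
    rw [← he, show e = fun _ => 1 from funext hall] at hs
    rw [hs]
    simp
  exact Finset.sum_lt_sum (fun j _ => Real.log_le_sub_one_of_pos (hpos j))
    ⟨i, Finset.mem_univ i, Real.log_lt_sub_one_of_pos (hpos i) hi⟩

/-- As a function of the covariance `W`, the Gaussian cross-entropy `log det W + tr (W⁻¹ A)` has
its unique minimum at `W = A`: apply the previous inequality to `W^{-1/2} A W^{-1/2}`. -/
lemma log_det_add_card_lt {A W : Matrix ι ι ℝ} (hA : A.PosDef) (hW : W.PosDef) (hne : W ≠ A) :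
    Real.log A.det + Fintype.card ι < Real.log W.det + (W⁻¹ * A).trace := by
  set R : Matrix ι ι ℝ := CFC.sqrt W⁻¹ with hR
  have hRR : R * R = W⁻¹ := CFC.sqrt_mul_sqrt_self _ hW.inv.posSemidef.nonneg
  have hRs : Rᴴ = R := (CFC.sqrt_nonneg W⁻¹).isSelfAdjoint
  have hdetR : R.det * R.det = (W.det)⁻¹ := by
    rw [← det_mul, hRR, det_nonsing_inv, Ring.inverse_eq_inv']
  have hWp := hW.det_pos
  have hAp := hA.det_pos
  have hRu : IsUnit R := by
    rw [isUnit_iff_isUnit_det, isUnit_iff_ne_zero]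
    intro h
    rw [h, zero_mul] at hdetR
    exact (inv_pos.2 hWp).ne hdetR
  have hB : (R * A * R).PosDef := by
    have := (IsUnit.posDef_star_right_conjugate_iff hRu).2 hA
    rwa [star_eq_conjTranspose, hRs] at this
  have hB1 : R * A * R ≠ 1 := by
    intro h
    apply hne
    have h2 : A * W⁻¹ = 1 := by
      have h3 : R * (A * R) = 1 := by rw [← Matrix.mul_assoc, h]
      rw [← hRR, ← Matrix.mul_assoc]
      exact mul_eq_one_comm.1 h3
    rw [← Matrix.inv_eq_left_inv h2, nonsing_inv_nonsing_inv _ hWp.ne'.isUnit]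
  have hlt := log_det_lt_trace_sub_card hB hB1
  have htr : (R * A * R).trace = (W⁻¹ * A).trace := by
    rw [trace_mul_comm, ← Matrix.mul_assoc, hRR]
  have hdet : (R * A * R).det = (W.det)⁻¹ * A.det := by
    rw [det_mul, det_mul, mul_right_comm, hdetR]
  rw [htr, hdet, Real.log_mul (inv_pos.2 hWp).ne' hAp.ne', Real.log_inv] at hlt
  linarith

lemma log_det_add_card_le {A W : Matrix ι ι ℝ} (hA : A.PosDef) (hW : W.PosDef) :
    Real.log A.det + Fintype.card ι ≤ Real.log W.det + (W⁻¹ * A).trace := by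
  by_cases h : W = A
  · rw [h, nonsing_inv_mul _ hA.det_pos.ne'.isUnit, trace_one]
  · exact (log_det_add_card_lt hA hW h).le

end

lemma log_add_one_lt {r d : ℝ} (hr : 0 < r) (hd : 0 < d) (hne : d ≠ r) :
    Real.log r + 1 < Real.log d + d⁻¹ * r := by
  have h := Real.log_lt_sub_one_of_pos (mul_pos (inv_pos.2 hd) hr)
    (fun h => hne (by field_simp at h; exact h.symm))
  rw [Real.log_mul (inv_pos.2 hd).ne' hr.ne', Real.log_inv] at h
  linarith

lemma log_add_one_le {r d : ℝ} (hr : 0 < r) (hd : 0 < d) :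
    Real.log r + 1 ≤ Real.log d + d⁻¹ * r := by
  by_cases h : d = r
  · rw [h, inv_mul_cancel₀ hr.ne']
  · exact (log_add_one_lt hr hd h).le

/-! ### The residual variances -/

lemma _root_.Matrix.PosSemidef.transpose_eq {ι : Type*} {M : Matrix ι ι ℝ} (h : M.PosSemidef) :
    Mᵀ = M := by
  simpa [IsHermitian, conjTranspose_eq_transpose_of_trivial] using h.isHermitian

lemma _root_.Matrix.mul_mul_transpose_apply_self {ι κ : Type*} [Fintype κ] (A : Matrix ι κ ℝ)
    (M : Matrix κ κ ℝ) (i : ι) : (A * M * Aᵀ) i i = A i ⬝ᵥ (M *ᵥ A i) := by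
  rw [Matrix.mul_assoc, Matrix.mul_apply]
  simp only [dotProduct, mulVec, Matrix.mul_apply, transpose_apply]

lemma posDef_Css (hθ : θ.Admissible) (F₁ : Matrix (Fin n) (Fin n₁) ℝ)
    {C : Matrix (Fin n) (Fin n) ℝ} (hC : C.PosSemidef) : (Css F₁ C θ).PosDef := by
  have h := hC.mul_mul_conjTranspose_same (postGain F₁ θ)
  rw [conjTranspose_eq_transpose_of_trivial] at h
  exact (hθ.posDef_postCov F₁).add_posSemidef h

lemma posDef_Css₁₁ (hθ : θ.Admissible) (F₁ : Matrix (Fin n) (Fin n₁) ℝ)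
    {C : Matrix (Fin n) (Fin n) ℝ} (hC : C.PosSemidef) : (Css F₁ C θ).toBlocks₁₁.PosDef :=
  (posDef_Css hθ F₁ hC).submatrix Sum.inl_injective

lemma posDef_Css₂₂ (hθ : θ.Admissible) (F₁ : Matrix (Fin n) (Fin n₁) ℝ)
    {C : Matrix (Fin n) (Fin n) ℝ} (hC : C.PosSemidef) : (Css F₁ C θ).toBlocks₂₂.PosDef :=
  (posDef_Css hθ F₁ hC).submatrix Sum.inr_injective

/-- The second-moment matrix of the residuals `x - F̃ s`, up to symmetrization: the expectation
is over the returns and over the posterior of the factors given by `θ`. -/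
noncomputable def residualMoment (F₁ : Matrix (Fin n) (Fin n₁) ℝ) (C : Matrix (Fin n) (Fin n) ℝ)
    (θ : Params n n₁ n₂) (F₂ : Matrix (Fin n) (Fin n₂) ℝ) : Matrix (Fin n) (Fin n) ℝ :=
  C - (2 : ℝ) • (Cxs F₁ C θ * (fromCols F₁ F₂)ᵀ) +
    fromCols F₁ F₂ * Css F₁ C θ * (fromCols F₁ F₂)ᵀ

lemma newF₂_eq (F₁ : Matrix (Fin n) (Fin n₁) ℝ) (C : Matrix (Fin n) (Fin n) ℝ)
    (θ : Params n n₁ n₂) :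
    newF₂ F₁ C θ = CxsTilde F₁ C θ * ((Css F₁ C θ).toBlocks₂₂)⁻¹ := rfl

/-- Completing the square in the free exposures `F₂`. -/
lemma residualMoment_diag (hθ : θ.Admissible) (F₁ : Matrix (Fin n) (Fin n₁) ℝ)
    {C : Matrix (Fin n) (Fin n) ℝ} (hC : C.PosSemidef) (F₂ : Matrix (Fin n) (Fin n₂) ℝ)
    (i : Fin n) :
    residualMoment F₁ C θ F₂ i i =
      (sigmaTilde F₁ C θ - CxsTilde F₁ C θ * ((Css F₁ C θ).toBlocks₂₂)⁻¹ *
        (CxsTilde F₁ C θ)ᵀ) i i +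
      ((F₂ - newF₂ F₁ C θ) * (Css F₁ C θ).toBlocks₂₂ * (F₂ - newF₂ F₁ C θ)ᵀ) i i := by
  set A := (Css F₁ C θ).toBlocks₁₁ with hA
  set B := (Css F₁ C θ).toBlocks₁₂ with hB
  set K := (Css F₁ C θ).toBlocks₂₂ with hK
  set H := CxsTilde F₁ C θ with hH
  have hKp : K.PosDef := posDef_Css₂₂ hθ F₁ hC
  have hKu : IsUnit K.det := hKp.det_pos.ne'.isUnit
  have hKt : Kᵀ = K := hKp.transpose_eq
  have hKit : (K⁻¹)ᵀ = K⁻¹ := hKp.inv.transpose_eq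
  have hB21 : (Css F₁ C θ).toBlocks₂₁ = Bᵀ := by
    have h := (posDef_Css hθ F₁ hC).transpose_eq
    ext a b
    exact (congrFun (congrFun h _) _).symm
  have hCss : Css F₁ C θ = fromBlocks A B Bᵀ K := by
    rw [← hB21, fromBlocks_toBlocks]
  have hCxs : Cxs F₁ C θ =
      fromCols (C * (postGain F₁ θ).toRows₁ᵀ) (C * (postGain F₁ θ).toRows₂ᵀ) := by
    rw [← mul_fromCols, ← transpose_fromRows, fromRows_toRows]; rfl
  have hH2 : C * (postGain F₁ θ).toRows₂ᵀ = H + F₁ * B := by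
    rw [hH, CxsTilde, sub_add_cancel]
  have hquad : (F₂ - newF₂ F₁ C θ) * K * (F₂ - newF₂ F₁ C θ)ᵀ =
      F₂ * K * F₂ᵀ - F₂ * Hᵀ - H * F₂ᵀ + H * K⁻¹ * Hᵀ := by
    have h1 : newF₂ F₁ C θ * K = H := by
      rw [newF₂_eq, nonsing_inv_mul_cancel_right _ _ hKu]
    have h2 : K * (newF₂ F₁ C θ)ᵀ = Hᵀ := by
      rw [← h1, transpose_mul, hKt]
    have h3 : H * (newF₂ F₁ C θ)ᵀ = H * K⁻¹ * Hᵀ := by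
      rw [newF₂_eq, transpose_mul, hKit, Matrix.mul_assoc]
    rw [Matrix.sub_mul, h1, transpose_sub, Matrix.mul_sub, Matrix.sub_mul, Matrix.sub_mul, h3,
      Matrix.mul_assoc F₂ K (newF₂ F₁ C θ)ᵀ, h2]
    abel
  have ht1 : (F₂ * Hᵀ) i i = (H * F₂ᵀ) i i := by
    rw [← transpose_apply (H * F₂ᵀ), transpose_mul, transpose_transpose]
  have ht2 : (F₂ * (Bᵀ * F₁ᵀ)) i i = (F₁ * (B * F₂ᵀ)) i i := by
    rw [← transpose_apply (F₁ * (B * F₂ᵀ)), transpose_mul, transpose_mul, transpose_transpose,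
      Matrix.mul_assoc]
  rw [hquad, residualMoment, hCss, hCxs, hH2, sigmaTilde, ← hA]
  simp only [transpose_fromCols, fromCols_mul_fromRows, fromCols_mul_fromBlocks, Matrix.add_mul,
    Matrix.add_apply, Matrix.sub_apply, Matrix.smul_apply, smul_eq_mul, Matrix.mul_assoc] at ht1 ht2 ⊢
  rw [ht1, ht2]
  ring

lemma emStep_D_apply (F₁ : Matrix (Fin n) (Fin n₁) ℝ) (C : Matrix (Fin n) (Fin n) ℝ)
    (θ : Params n n₁ n₂) (i : Fin n) :
    (emStep F₁ C θ).D i = residualMoment F₁ C θ (newF₂ F₁ C θ) i i := rfl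

lemma emStep_D_eq (hθ : θ.Admissible) (F₁ : Matrix (Fin n) (Fin n₁) ℝ)
    {C : Matrix (Fin n) (Fin n) ℝ} (hC : C.PosSemidef) :
    (emStep F₁ C θ).D = diag (sigmaTilde F₁ C θ - CxsTilde F₁ C θ *
      ((Css F₁ C θ).toBlocks₂₂)⁻¹ * (CxsTilde F₁ C θ)ᵀ) := by
  ext i
  rw [emStep_D_apply, residualMoment_diag hθ F₁ hC]
  simp

lemma residualMoment_eq_add_quadratic (hθ : θ.Admissible) (F₁ : Matrix (Fin n) (Fin n₁) ℝ)
    {C : Matrix (Fin n) (Fin n) ℝ} (hC : C.PosSemidef) (F₂ : Matrix (Fin n) (Fin n₂) ℝ)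
    (i : Fin n) :
    residualMoment F₁ C θ F₂ i i = (emStep F₁ C θ).D i +
      (F₂ - newF₂ F₁ C θ) i ⬝ᵥ ((Css F₁ C θ).toBlocks₂₂ *ᵥ (F₂ - newF₂ F₁ C θ) i) := by
  rw [residualMoment_diag hθ F₁ hC, emStep_D_eq hθ F₁ hC, ← mul_mul_transpose_apply_self]
  rfl

/-- The residual variance of an asset is the posterior variance of its factor part plus the mean
square of the error of prediction by the posterior mean. -/
lemma residualMoment_diag_eq_add (F₁ : Matrix (Fin n) (Fin n₁) ℝ) (θ : Params n n₁ n₂)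
    {C : Matrix (Fin n) (Fin n) ℝ} (hC : C.PosSemidef) (F₂ : Matrix (Fin n) (Fin n₂) ℝ)
    (i : Fin n) :
    residualMoment F₁ C θ F₂ i i =
      fromCols F₁ F₂ i ⬝ᵥ (postCov F₁ θ *ᵥ fromCols F₁ F₂ i) +
      ((1 - fromCols F₁ F₂ * postGain F₁ θ) * C * (1 - fromCols F₁ F₂ * postGain F₁ θ)ᵀ :
        Matrix (Fin n) (Fin n) ℝ) i i := by
  set F := fromCols F₁ F₂
  set L := postGain F₁ θ
  have h1 : (F * (L * C)) i i = (C * (Lᵀ * Fᵀ)) i i := by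
    rw [← transpose_apply (C * (Lᵀ * Fᵀ)), transpose_mul, transpose_mul, transpose_transpose,
      transpose_transpose, hC.transpose_eq, Matrix.mul_assoc]
  rw [← mul_mul_transpose_apply_self, residualMoment, Cxs, Css]
  simp only [transpose_sub, transpose_one, transpose_mul, Matrix.sub_mul, Matrix.mul_sub,
    Matrix.one_mul, Matrix.mul_one, Matrix.mul_add, Matrix.add_mul, Matrix.add_apply,
    Matrix.sub_apply, Matrix.smul_apply, smul_eq_mul, Matrix.mul_assoc]
  simp only [F, L] at h1 ⊢
  rw [h1]
  ring

lemma residualMoment_diag_pos (hθ : θ.Admissible) (F₁ : Matrix (Fin n) (Fin n₁) ℝ)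
    {C : Matrix (Fin n) (Fin n) ℝ} (hC : C.PosSemidef) (F₂ : Matrix (Fin n) (Fin n₂) ℝ)
    {i : Fin n} (hi : (∃ j, F₁ i j ≠ 0) ∨ 0 < C i i) : 0 < residualMoment F₁ C θ F₂ i i := by
  by_cases hF : fromCols F₁ F₂ i = 0
  · have hj (j : Fin n₁) : F₁ i j = 0 := by simpa using congrFun hF (Sum.inl j)
    have hz (M : Matrix (Fin n₁ ⊕ Fin n₂) (Fin n) ℝ) : (fromCols F₁ F₂ * M) i i = 0 := by
      rw [Matrix.mul_apply]
      exact Finset.sum_eq_zero fun a _ => by rw [hF, Pi.zero_apply, zero_mul]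
    have hz' (M : Matrix (Fin n) (Fin n₁ ⊕ Fin n₂) ℝ) : (M * (fromCols F₁ F₂)ᵀ) i i = 0 := by
      rw [Matrix.mul_apply]
      exact Finset.sum_eq_zero fun a _ => by
        rw [transpose_apply, hF, Pi.zero_apply, mul_zero]
    rw [residualMoment, Matrix.add_apply, Matrix.sub_apply, Matrix.smul_apply, hz', hz', smul_zero,
      sub_zero, add_zero]
    rcases hi with ⟨j, h⟩ | h
    · exact absurd (hj j) h
    · exact h
  · rw [residualMoment_diag_eq_add F₁ θ hC]
    have h1 := (hθ.posDef_postCov F₁).dotProduct_mulVec_pos hF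
    have h2 := (hC.mul_mul_conjTranspose_same
      (1 - fromCols F₁ F₂ * postGain F₁ θ)).diag_nonneg (i := i)
    rw [star_trivial] at h1
    rw [conjTranspose_eq_transpose_of_trivial] at h2
    linarith

/-! ### The M-step -/

lemma emStep_admissible (hθ : θ.Admissible) (F₁ : Matrix (Fin n) (Fin n₁) ℝ)
    {C : Matrix (Fin n) (Fin n) ℝ} (hC : C.PosSemidef)
    (hpos : ∀ i, (∃ j, F₁ i j ≠ 0) ∨ 0 < C i i) : (emStep F₁ C θ).Admissible :=
  ⟨posDef_Css₁₁ hθ F₁ hC, fun i => residualMoment_diag_pos hθ F₁ hC _ (hpos i)⟩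

lemma inv_Ωtilde (hθ : θ.Admissible) : θ.Ωtilde⁻¹ = fromBlocks θ.Ω⁻¹ 0 0 1 := by
  refine Matrix.inv_eq_right_inv ?_
  rw [Params.Ωtilde, fromBlocks_multiply]
  simp [mul_nonsing_inv _ hθ.1.det_pos.ne'.isUnit]

/-- The M-step objective separates into a term for each asset, involving `D i` and row `i` of `F₂`,
and a term for `Ω`. -/
lemma Qmoments_eq (hθ : θ.Admissible) (F₁ : Matrix (Fin n) (Fin n₁) ℝ)
    (C : Matrix (Fin n) (Fin n) ℝ) (θk : Params n n₁ n₂) :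
    Qmoments F₁ C θ θk =
      -(1 / 2) * ((n + (n₁ + n₂)) * Real.log (2 * Real.pi) + (Css F₁ C θk).toBlocks₂₂.trace)
      - 1 / 2 * ∑ i, (Real.log (θ.D i) + (θ.D i)⁻¹ * residualMoment F₁ C θk θ.F₂ i i)
      - 1 / 2 * (Real.log θ.Ω.det + (θ.Ω⁻¹ * (Css F₁ C θk).toBlocks₁₁).trace) := by
  have hdetD : Real.log θ.Dmat.det = ∑ i, Real.log (θ.D i) := by
    rw [Params.Dmat, det_diagonal, Real.log_prod fun i _ => (hθ.2 i).ne']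
  have hdetΩ : θ.Ωtilde.det = θ.Ω.det := by
    rw [Params.Ωtilde, det_fromBlocks_zero₂₁, det_one, mul_one]
  have hres (i : Fin n) : C i i - 2 * ∑ a, θ.Ftilde F₁ i a * Cxs F₁ C θk i a +
        ∑ a, ∑ b, θ.Ftilde F₁ i a * θ.Ftilde F₁ i b * Css F₁ C θk a b =
      residualMoment F₁ C θk θ.F₂ i i := by
    rw [residualMoment, Matrix.add_apply, Matrix.sub_apply, Matrix.smul_apply, smul_eq_mul,
      mul_mul_transpose_apply_self, Matrix.mul_apply]
    simp only [dotProduct, mulVec, transpose_apply, Finset.mul_sum, Params.Ftilde]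
    congr 1
    · congr 1
      exact Finset.sum_congr rfl fun a _ => by ring
    · exact Finset.sum_congr rfl fun a _ => Finset.sum_congr rfl fun b _ => by ring
  have htr : ∑ a, ∑ b, θ.Ωtilde⁻¹ a b * Css F₁ C θk a b =
      (θ.Ω⁻¹ * (Css F₁ C θk).toBlocks₁₁).trace + (Css F₁ C θk).toBlocks₂₂.trace := by
    rw [inv_Ωtilde hθ]
    simp only [Fintype.sum_sum_type, fromBlocks_apply₁₁, fromBlocks_apply₁₂, fromBlocks_apply₂₁,
      fromBlocks_apply₂₂, Matrix.zero_apply, zero_mul, Finset.sum_const_zero, add_zero, zero_add,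
      Matrix.one_apply, ite_mul, one_mul, Finset.sum_ite_eq, Finset.mem_univ, if_true]
    congr 1
    conv_rhs => rw [← hθ.1.inv.transpose_eq]
    simp only [Matrix.trace, diag_apply, Matrix.mul_apply, transpose_apply]
    exact Finset.sum_comm
  simp only [Qmoments, hres, htr, logNormalizer, hdetD, hdetΩ, Finset.sum_add_distrib,
    Fintype.card_sum, Fintype.card_fin]
  push_cast
  ring

/-- The M-step update is the unique maximizer of the M-step objective. -/
lemma Qmoments_lt (hθ : θ.Admissible) (hθk : θk.Admissible) (F₁ : Matrix (Fin n) (Fin n₁) ℝ)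
    {C : Matrix (Fin n) (Fin n) ℝ} (hC : C.PosSemidef)
    (hpos : ∀ i, (∃ j, F₁ i j ≠ 0) ∨ 0 < C i i) (hne : θ ≠ emStep F₁ C θk) :
    Qmoments F₁ C θ θk < Qmoments F₁ C (emStep F₁ C θk) θk := by
  have hadm := emStep_admissible hθk F₁ hC hpos
  set θp := emStep F₁ C θk with hθp
  have hC11 : (Css F₁ C θk).toBlocks₁₁ = θp.Ω := rfl
  have hF2 : newF₂ F₁ C θk = θp.F₂ := rfl
  rw [Qmoments_eq hθ, Qmoments_eq hadm, hC11,
    nonsing_inv_mul _ hadm.1.det_pos.ne'.isUnit, trace_one]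
  have hrp (i : Fin n) : (θp.D i)⁻¹ * residualMoment F₁ C θk θp.F₂ i i = 1 :=
    inv_mul_cancel₀ (hadm.2 i).ne'
  have hr (i : Fin n) : residualMoment F₁ C θk θ.F₂ i i = θp.D i +
      (θ.F₂ - θp.F₂) i ⬝ᵥ ((Css F₁ C θk).toBlocks₂₂ *ᵥ (θ.F₂ - θp.F₂) i) :=
    residualMoment_eq_add_quadratic hθk F₁ hC _ i
  simp only [hrp, hr, mul_add]
  set q : Fin n → ℝ := fun i => (θ.D i)⁻¹ *
    ((θ.F₂ - θp.F₂) i ⬝ᵥ ((Css F₁ C θk).toBlocks₂₂ *ᵥ (θ.F₂ - θp.F₂) i)) with hq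
  have hK := posDef_Css₂₂ hθk F₁ hC
  have hq0 (i : Fin n) : 0 ≤ q i := by
    have := hK.posSemidef.dotProduct_mulVec_nonneg ((θ.F₂ - θp.F₂) i)
    rw [star_trivial] at this
    exact mul_nonneg (inv_pos.2 (hθ.2 i)).le this
  have hle (i : Fin n) : Real.log (θp.D i) + 1 ≤
      Real.log (θ.D i) + ((θ.D i)⁻¹ * θp.D i + q i) := by
    linarith [log_add_one_le (hadm.2 i) (hθ.2 i), hq0 i]
  have hsum := Finset.sum_le_sum fun i (_ : i ∈ Finset.univ) => hle i
  have hΩ := log_det_add_card_le hadm.1 hθ.1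
  by_cases hΩne : θ.Ω = θp.Ω
  · -- some asset has a different specific variance or a different row of exposures
    obtain ⟨i, hi⟩ : ∃ i, θ.D i ≠ θp.D i ∨ θ.F₂ i ≠ θp.F₂ i := by
      by_contra! hall
      exact hne (Params.ext (funext fun i => (hall i).2) hΩne (funext fun i => (hall i).1))
    have hlt : Real.log (θp.D i) + 1 < Real.log (θ.D i) + ((θ.D i)⁻¹ * θp.D i + q i) := by
      rcases hi with hi | hi
      · linarith [log_add_one_lt (hadm.2 i) (hθ.2 i) hi, hq0 i]
      · have hne0 : (θ.F₂ - θp.F₂) i ≠ 0 := sub_ne_zero.2 hi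
        have := hK.dotProduct_mulVec_pos hne0
        rw [star_trivial] at this
        have hqi : 0 < q i := mul_pos (inv_pos.2 (hθ.2 i)) this
        linarith [log_add_one_le (hadm.2 i) (hθ.2 i)]
    have hsumlt := Finset.sum_lt_sum (fun i (_ : i ∈ Finset.univ) => hle i)
      ⟨i, Finset.mem_univ i, hlt⟩
    linarith
  · have hΩlt := log_det_add_card_lt hadm.1 hθ.1 hΩne
    linarith

/-! ### Monotonicity of the likelihood -/

lemma log_jointDensity_eq_add (hθ : θ.Admissible) (F₁ : Matrix (Fin n) (Fin n₁) ℝ)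
    (y : EuclideanSpace ℝ (Fin n)) (s : EuclideanSpace ℝ (Fin n₁ ⊕ Fin n₂)) :
    Real.log (jointDensity F₁ θ y s) =
      Real.log (returnDensity F₁ θ y) + Real.log (condDensity F₁ θ y s) := by
  have h1 := returnDensity_pos hθ F₁ y
  have h2 := jointDensity_pos hθ F₁ y s
  rw [condDensity, Real.log_div h2.ne' h1.ne']
  ring

/-- The gain in log-likelihood is at least the gain in the expected complete-data log-likelihood;
the difference is the relative entropy of the two posteriors, nonnegative by `log t ≤ t - 1`. -/
lemma expectedLogJoint_sub_le (hθ : θ.Admissible) (hθk : θk.Admissible)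
    (F₁ : Matrix (Fin n) (Fin n₁) ℝ) (y : EuclideanSpace ℝ (Fin n)) :
    expectedLogJoint F₁ θ θk y - expectedLogJoint F₁ θk θk y ≤
      Real.log (returnDensity F₁ θ y) - Real.log (returnDensity F₁ θk y) := by
  set c := Real.log (returnDensity F₁ θ y) - Real.log (returnDensity F₁ θk y) with hc
  have hi := integrable_condDensity_mul_log_jointDensity hθ hθk F₁ y
  have hik := integrable_condDensity_mul_log_jointDensity hθk hθk F₁ y
  have hg (θ' : Params n n₁ n₂) (hθ' : θ'.Admissible) :
      HasMean volume (condDensity F₁ θ' y) 1 := by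
    rw [show condDensity F₁ θ' y = _ from funext (condDensity_eq hθ' F₁ y)]
    exact ⟨integrable_gaussianDensity _ (hθ'.posDef_postCov F₁),
      integral_gaussianDensity _ (hθ'.posDef_postCov F₁)⟩
  rw [expectedLogJoint, expectedLogJoint, ← integral_sub hi hik]
  have hbound := ((hg θ hθ).sub (hg θk hθk)).add ((hg θk hθk).const_mul c)
  rw [sub_self, zero_add, mul_one] at hbound
  rw [← hbound.integral_eq]
  refine integral_mono (hi.sub hik) hbound.integrable fun s => ?_
  have hp : 0 < condDensity F₁ θ y s :=
    div_pos (jointDensity_pos hθ F₁ y s) (returnDensity_pos hθ F₁ y)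
  have hpk : 0 < condDensity F₁ θk y s :=
    div_pos (jointDensity_pos hθk F₁ y s) (returnDensity_pos hθk F₁ y)
  have hlog := Real.log_le_sub_one_of_pos (div_pos hp hpk)
  rw [Real.log_div hp.ne' hpk.ne'] at hlog
  have hmul := mul_le_mul_of_nonneg_left hlog hpk.le
  rw [mul_sub, mul_sub, mul_div_cancel₀ _ hpk.ne', mul_one] at hmul
  simp only [log_jointDensity_eq_add hθ, log_jointDensity_eq_add hθk]
  rw [hc]
  linarith

lemma logLik_emStep_le (hθk : θk.Admissible) (F₁ : Matrix (Fin n) (Fin n₁) ℝ)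
    (x : Fin T → EuclideanSpace ℝ (Fin n)) {w : Fin T → ℝ} (hw : ∀ τ, 0 ≤ w τ)
    (hw1 : ∑ τ, w τ = 1) (hpos : ∀ i, (∃ j, F₁ i j ≠ 0) ∨ 0 < secondMoment x w i i) :
    logLik F₁ x w θk ≤ logLik F₁ x w (emStep F₁ (secondMoment x w) θk) := by
  set θp := emStep F₁ (secondMoment x w) θk with hθp
  have hC := posSemidef_secondMoment x hw
  have hadm : θp.Admissible := emStep_admissible hθk F₁ hC hpos
  by_cases hne : θk = θp
  · rw [← hne]
  have hQ : Qweighted F₁ x w θk θk < Qweighted F₁ x w θp θk := by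
    rw [Qweighted_eq hθk hθk F₁ x hw hw1, Qweighted_eq hadm hθk F₁ x hw hw1]
    exact Qmoments_lt hθk hθk F₁ hC hpos hne
  have hle : Qweighted F₁ x w θp θk - Qweighted F₁ x w θk θk ≤
      logLik F₁ x w θp - logLik F₁ x w θk := by
    simp only [Qweighted, logLik, ← Finset.sum_sub_distrib, ← mul_sub]
    exact Finset.sum_le_sum fun τ _ =>
      mul_le_mul_of_nonneg_left (expectedLogJoint_sub_le hadm hθk F₁ (x τ)) (hw τ)
  linarith

lemma secondMoment_diag_pos (x : Fin T → EuclideanSpace ℝ (Fin n)) {w : Fin T → ℝ}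
    (hw : ∀ τ, 0 ≤ w τ) {i : Fin n} (hi : ∃ τ, 0 < w τ ∧ x τ i ≠ 0) :
    0 < secondMoment x w i i := by
  obtain ⟨τ, hτ, hx⟩ := hi
  rw [secondMoment_apply]
  exact Finset.sum_pos' (fun t _ => mul_nonneg (hw t) (mul_self_nonneg _))
    ⟨τ, Finset.mem_univ τ, mul_pos hτ (mul_self_pos.2 hx)⟩

end FactorEM

theorem mainTheorem4 (n n₁ n₂ T : ℕ) (F₁ : Matrix (Fin n) (Fin n₁) ℝ)
    (x : Fin T → EuclideanSpace ℝ (Fin n)) (w : Fin T → ℝ)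
    (hw : ∀ τ, 0 ≤ w τ) (hw1 : ∑ τ, w τ = 1) :
    -- E-step, for the random variables of the model
    (∀ θ : FactorEM.Params n n₁ n₂, θ.Admissible →
      ∀ (Ω' : Type*) [MeasurableSpace Ω'] (P : Measure Ω') [IsProbabilityMeasure P]
        (S : Ω' → EuclideanSpace ℝ (Fin n₁ ⊕ Fin n₂)) (E X : Ω' → EuclideanSpace ℝ (Fin n)),
        HasLaw S (multivariateGaussian 0 θ.Ωtilde) P →
        HasLaw E (multivariateGaussian 0 θ.Dmat) P →
        IndepFun S E P →
        (∀ ω, X ω = FactorEM.mulE (θ.Ftilde F₁) (S ω) + E ω) →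
        HasLaw X (multivariateGaussian 0 (FactorEM.modelCov F₁ θ)) P ∧
        HasLaw (fun ω => (X ω, S ω)) (volume.withDensity fun z =>
          ENNReal.ofReal (FactorEM.jointDensity F₁ θ z.1 z.2)) P ∧
        condDistrib S X P =ᵐ[P.map X] fun y =>
          multivariateGaussian (FactorEM.mulE (FactorEM.postGain F₁ θ) y)
            (FactorEM.postCov F₁ θ)) ∧
    -- E-step, through the densities and at every point, with the matrices `G`, `L`, `C_ss`, `C_xs`
    (∀ θ : FactorEM.Params n n₁ n₂, θ.Admissible →
      (FactorEM.postCov F₁ θ).PosDef ∧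
      (FactorEM.postCov F₁ θ)⁻¹ = (θ.Ftilde F₁)ᵀ * θ.Dmat⁻¹ * θ.Ftilde F₁ + θ.Ωtilde⁻¹ ∧
      FactorEM.postGain F₁ θ = FactorEM.postCov F₁ θ * (θ.Ftilde F₁)ᵀ * θ.Dmat⁻¹ ∧
      (∀ y : EuclideanSpace ℝ (Fin n),
        0 < FactorEM.returnDensity F₁ θ y ∧
        Integrable (fun s => FactorEM.jointDensity F₁ θ y s) ∧
        ∫ s, FactorEM.jointDensity F₁ θ y s = FactorEM.returnDensity F₁ θ y ∧
        (volume.withDensity fun s => ENNReal.ofReal (FactorEM.condDensity F₁ θ y s)) =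
          multivariateGaussian (FactorEM.mulE (FactorEM.postGain F₁ θ) y)
            (FactorEM.postCov F₁ θ)) ∧
      (∀ a b, FactorEM.Css F₁ (FactorEM.secondMoment x w) θ a b =
        ∑ τ, w τ * ∫ s, FactorEM.condDensity F₁ θ (x τ) s * (s a * s b)) ∧
      (∀ i a, FactorEM.Cxs F₁ (FactorEM.secondMoment x w) θ i a =
        ∑ τ, w τ * ∫ s, FactorEM.condDensity F₁ θ (x τ) s * (x τ i * s a))) ∧
    -- the two expressions of the update agree
    (∀ θ : FactorEM.Params n n₁ n₂, θ.Admissible →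
      ((FactorEM.Css F₁ (FactorEM.secondMoment x w) θ).toBlocks₂₂).PosDef ∧
      (FactorEM.emStep F₁ (FactorEM.secondMoment x w) θ).F₂ =
        FactorEM.CxsTilde F₁ (FactorEM.secondMoment x w) θ *
          ((FactorEM.Css F₁ (FactorEM.secondMoment x w) θ).toBlocks₂₂)⁻¹ ∧
      (FactorEM.emStep F₁ (FactorEM.secondMoment x w) θ).D =
        Matrix.diag (FactorEM.sigmaTilde F₁ (FactorEM.secondMoment x w) θ -
          FactorEM.CxsTilde F₁ (FactorEM.secondMoment x w) θ *
            ((FactorEM.Css F₁ (FactorEM.secondMoment x w) θ).toBlocks₂₂)⁻¹ *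
            (FactorEM.CxsTilde F₁ (FactorEM.secondMoment x w) θ)ᵀ)) ∧
    -- the objectives are genuine integrals, and the expectations over `N(0, C)` are the weighted sums
    (∀ θ θk : FactorEM.Params n n₁ n₂, θ.Admissible → θk.Admissible →
      (∀ y : EuclideanSpace ℝ (Fin n), Integrable fun s =>
        FactorEM.condDensity F₁ θk y s * Real.log (FactorEM.jointDensity F₁ θ y s)) ∧
      Integrable (FactorEM.expectedLogJoint F₁ θ θk)
        (multivariateGaussian 0 (FactorEM.secondMoment x w)) ∧
      Integrable (fun y => Real.log (FactorEM.returnDensity F₁ θ y))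
        (multivariateGaussian 0 (FactorEM.secondMoment x w)) ∧
      FactorEM.Qgaussian F₁ (FactorEM.secondMoment x w) θ θk =
        FactorEM.Qweighted F₁ x w θ θk ∧
      FactorEM.expLogLik F₁ (FactorEM.secondMoment x w) θ = FactorEM.logLik F₁ x w θ) ∧
    -- the initialization of the algorithm is admissible
    (∀ (Ωbase : Matrix (Fin n₁) (Fin n₁) ℝ) (ν : ℝ) (θ₀ : FactorEM.Params n n₁ n₂),
      Ωbase.PosDef → 0 < ν → FactorEM.IsInitialization F₁ Ωbase x w ν θ₀ → θ₀.Admissible) ∧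
    -- M-step and monotonicity
    ((∀ i, (∃ j, F₁ i j ≠ 0) ∨ ∃ τ, 0 < w τ ∧ x τ i ≠ 0) →
      (∀ θk : FactorEM.Params n n₁ n₂, θk.Admissible →
        (FactorEM.emStep F₁ (FactorEM.secondMoment x w) θk).Admissible ∧
        (∀ θ : FactorEM.Params n n₁ n₂, θ.Admissible →
          θ ≠ FactorEM.emStep F₁ (FactorEM.secondMoment x w) θk →
          FactorEM.Qweighted F₁ x w θ θk <
            FactorEM.Qweighted F₁ x w
              (FactorEM.emStep F₁ (FactorEM.secondMoment x w) θk) θk ∧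
          FactorEM.Qgaussian F₁ (FactorEM.secondMoment x w) θ θk <
            FactorEM.Qgaussian F₁ (FactorEM.secondMoment x w)
              (FactorEM.emStep F₁ (FactorEM.secondMoment x w) θk) θk)) ∧
      (∀ θ₀ : FactorEM.Params n n₁ n₂, θ₀.Admissible →
        (∀ k : ℕ, ((FactorEM.emStep F₁ (FactorEM.secondMoment x w))^[k] θ₀).Admissible) ∧
        (Monotone fun k : ℕ =>
          FactorEM.logLik F₁ x w ((FactorEM.emStep F₁ (FactorEM.secondMoment x w))^[k] θ₀)) ∧
        (Monotone fun k : ℕ =>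
          FactorEM.expLogLik F₁ (FactorEM.secondMoment x w)
            ((FactorEM.emStep F₁ (FactorEM.secondMoment x w))^[k] θ₀)))) := by
  have hC := FactorEM.posSemidef_secondMoment x hw
  refine ⟨fun θ hθ Ω' _ P _ S E X hS hE hSE hX => FactorEM.model_laws hθ F₁ hS hE hSE hX,
    fun θ hθ => ⟨hθ.posDef_postCov F₁, ?_, rfl, fun y => ⟨FactorEM.returnDensity_pos hθ F₁ y,
      FactorEM.integrable_jointDensity hθ F₁ y, FactorEM.integral_jointDensity hθ F₁ y,
      FactorEM.withDensity_condDensity hθ F₁ y⟩, FactorEM.Css_eq_sum_integral hθ F₁ x hw hw1,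
      FactorEM.Cxs_eq_sum_integral hθ F₁ x hw hw1⟩,
    fun θ hθ => ⟨FactorEM.posDef_Css₂₂ hθ F₁ hC, rfl, FactorEM.emStep_D_eq hθ F₁ hC⟩,
    fun θ θk hθ hθk => ⟨FactorEM.integrable_condDensity_mul_log_jointDensity hθ hθk F₁, ?_, ?_, ?_,
      FactorEM.expLogLik_eq_logLik hθ F₁ x hw hw1⟩, ?_, fun hasset => ?_⟩
  · exact nonsing_inv_nonsing_inv _
      (FactorEM.posDef_precision hθ.posDef_Dmat hθ.posDef_Ωtilde _).det_pos.ne'.isUnit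
  · exact ((FactorEM.hasSecondMoment_multivariateGaussian hC).hasMean_expectedLogJoint hθ hθk
      F₁).integrable
  · exact ((FactorEM.hasSecondMoment_multivariateGaussian hC).hasMean_log_returnDensity hθ
      F₁).integrable
  · rw [FactorEM.Qgaussian_eq hθ hθk F₁ hC, FactorEM.Qweighted_eq hθ hθk F₁ x hw hw1]
  · rintro Ωbase ν θ₀ hΩ hν ⟨-, hΩ₀, hD⟩
    exact ⟨hΩ₀ ▸ hΩ, fun i => (hD i).symm ▸ lt_max_of_lt_right hν⟩
  · have hpos (i : Fin n) : (∃ j, F₁ i j ≠ 0) ∨ 0 < FactorEM.secondMoment x w i i :=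
      (hasset i).imp_right (FactorEM.secondMoment_diag_pos x hw)
    have hadm (θ : FactorEM.Params n n₁ n₂) (hθ : θ.Admissible) :=
      FactorEM.emStep_admissible hθ F₁ hC hpos
    refine ⟨fun θk hθk => ⟨hadm θk hθk, fun θ hθ hne => ?_⟩, fun θ₀ hθ₀ => ?_⟩
    · have hlt := FactorEM.Qmoments_lt hθ hθk F₁ hC hpos hne
      rw [FactorEM.Qweighted_eq hθ hθk F₁ x hw hw1,
        FactorEM.Qweighted_eq (hadm θk hθk) hθk F₁ x hw hw1, FactorEM.Qgaussian_eq hθ hθk F₁ hC,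
        FactorEM.Qgaussian_eq (hadm θk hθk) hθk F₁ hC]
      exact ⟨hlt, hlt⟩
    · have hiter (k : ℕ) :
          ((FactorEM.emStep F₁ (FactorEM.secondMoment x w))^[k] θ₀).Admissible := by
        induction k with
        | zero => exact hθ₀
        | succ k ih =>
          rw [Function.iterate_succ_apply']
          exact hadm _ ih
      have hmono : Monotone fun k : ℕ => FactorEM.logLik F₁ x w
          ((FactorEM.emStep F₁ (FactorEM.secondMoment x w))^[k] θ₀) :=
        monotone_nat_of_le_succ fun k => by
          rw [Function.iterate_succ_apply']
          exact FactorEM.logLik_emStep_le (hiter k) F₁ x hw hw1 hpos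
      refine ⟨hiter, hmono, ?_⟩
      simpa only [FactorEM.expLogLik_eq_logLik (hiter _) F₁ x hw hw1] using hmono
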